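/- Let $E\subset\mathbb R^n$ be Lebesgue measurable and let $\omega_m$ denote the area of the unit sphere of $\mathbb R^m$ ($\omega_0:=0$). For $s\in(0,1)$ and $q\in\partial E$ let $$\mathcal I_s[E](q):=\lim_{\rho\to0^+}\int_{\mathbb R^n\setminus B_\rho(q)}\frac{\chi_{\mathbb R^n\setminus E}(y)-\chi_E(y)}{|y-q|^{n+s}}\,dy$$ be the $s$-fractional mean curvature, and let $$\overline\alpha(E):=\limsup_{s\to0^+}\,s\int_{\mathbb R^n\setminus B_1(0)}\frac{\chi_E(y)}{|y|^{n+s}}\,dy .$$ Let $p\in\partial E$ and suppose that $\partial E\cap B_r(p)$ is of class $C^2$ for some $r>0$, that is, near each $x\in\partial E\cap B_r(p)$ there is a $C^2$ function $\varphi$ with $\nabla\varphi(x)\ne0$ such that, near $x$, $E$ coincides with $\{\varphi<0\}$ up to points of $\{\varphi=0\}$. Let $H[E](p)=\frac1{n-1}\operatorname{div}\big(\nabla\varphi/|\nabla\varphi|\big)(p)$ be the classical mean curvature of $E$ at $p$, i.e. the average of the $n-1$ principal curvatures, with the sign for which balls have positive curvature (for $n=1$, $H[E](p):=0$). Assume that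 $$H[E](p)<0\qquad\text{and}\qquad\overline\alpha(E)<\frac{\omega_n}2 .$$ Then the limit defining $\mathcal I_s[E](p)$ exists and is finite for every $s\in(0,1)$, and there are $0<\sigma_0<\tilde s<\sigma_1<1$ such that (i) $\mathcal I_s[E](p)>0$ for every $s\in(0,\sigma_0]$, and moreover $\displaystyle\liminf_{s\to0^+}s\,\mathcal I_s[E](p)=\omega_n-2\overline\alpha(E)$; (ii) $\mathcal I_{\tilde s}[E](p)=0$; (iii) $\mathcal I_s[E](p)<0$ for every $s\in[\sigma_1,1)$, and moreover $\displaystyle\lim_{s\to1^-}(1-s)\,\mathcal I_s[E](p)=\omega_{n-1}H[E](p)$. -/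

import Mathlib

open Set Filter Topology MeasureTheory Metric
open scoped Gradient

noncomputable section

/-- The area `ω_m` of the unit sphere of `ℝᵐ` (total mass of its surface measure);
it equals `m` times the volume of the unit ball, and `ω_0 = 0`. -/
def sphereArea (m : ℕ) : ℝ :=
  (volume : Measure (EuclideanSpace ℝ (Fin m))).toSphere.real univ

variable {n : ℕ}

/-- The truncated fractional mean curvature
`I_s^ρ[E](q) = ∫_{|y - q| ≥ ρ} (χ_{Eᶜ}(y) - χ_E(y)) / |y - q|^(n + s) dy`. -/
def fracMeanCurvatureTrunc (s ρ : ℝ) (E : Set (EuclideanSpace ℝ (Fin n)))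
    (q : EuclideanSpace ℝ (Fin n)) : ℝ :=
  ∫ y in (ball q ρ)ᶜ,
    (Eᶜ.indicator (fun _ => (1 : ℝ)) y - E.indicator (fun _ => (1 : ℝ)) y)
      / ‖y - q‖ ^ ((n : ℝ) + s)

/-- The fractional mean curvature `I_s[E](q) = lim_{ρ → 0⁺} I_s^ρ[E](q)`. It is meaningful where
this limit exists; existence has to be stated separately. -/
def fracMeanCurvature (s : ℝ) (E : Set (EuclideanSpace ℝ (Fin n)))
    (q : EuclideanSpace ℝ (Fin n)) : ℝ :=
  limUnder (𝓝[>] (0 : ℝ)) fun ρ => fracMeanCurvatureTrunc s ρ E q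

/-- The upper contribution from infinity
`limsup_{s → 0⁺} s ∫_{|y| ≥ 1} χ_E(y) / |y|^(n + s) dy`.
For `s > 0` the quantity under the `limsup` lies between `0` and `ω_n`. -/
def alphaBar (E : Set (EuclideanSpace ℝ (Fin n))) : ℝ :=
  limsup (fun s : ℝ => s * ∫ y in (ball (0 : EuclideanSpace ℝ (Fin n)) 1)ᶜ,
    E.indicator (fun _ => (1 : ℝ)) y / ‖y‖ ^ ((n : ℝ) + s)) (𝓝[>] (0 : ℝ))

/-- `φ` is a `C²` defining function of `E` near `x`: it is of class `C²` near `x`, its gradient does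
not vanish at `x`, and near `x` the set `E` is `{φ < 0}` up to points of the hypersurface
`{φ = 0}`. For instance `φ(y', yₙ) = u(y') - yₙ` if `E` is locally the supergraph of a
`C²` function `u`. -/
structure IsC2DefiningFunctionAt (E : Set (EuclideanSpace ℝ (Fin n)))
    (x : EuclideanSpace ℝ (Fin n)) (φ : EuclideanSpace ℝ (Fin n) → ℝ) : Prop where
  contDiffAt : ContDiffAt ℝ 2 φ x
  gradient_ne_zero : ∇ φ x ≠ 0
  mem_of_neg : ∀ᶠ y in 𝓝 x, φ y < 0 → y ∈ E
  notMem_of_pos : ∀ᶠ y in 𝓝 x, 0 < φ y → y ∉ E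

/-- `∂E ∩ U` is of class `C²`. -/
def HasC2BoundaryIn (E U : Set (EuclideanSpace ℝ (Fin n))) : Prop :=
  ∀ x ∈ frontier E ∩ U, ∃ φ, IsC2DefiningFunctionAt E x φ

/-- The vector field `∇φ / |∇φ|`, which on `{φ = 0}` is the unit normal pointing out of `{φ < 0}`. -/
def unitNormalField (φ : EuclideanSpace ℝ (Fin n) → ℝ) (x : EuclideanSpace ℝ (Fin n)) :
    EuclideanSpace ℝ (Fin n) :=
  ‖∇ φ x‖⁻¹ • ∇ φ x

/-- The mean curvature (average of the `n - 1` principal curvatures) at `x` of the level set of `φ`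
through `x`, namely `div (∇φ / |∇φ|) (x) / (n - 1)`. -/
def levelSetMeanCurvature (φ : EuclideanSpace ℝ (Fin n) → ℝ) (x : EuclideanSpace ℝ (Fin n)) : ℝ :=
  LinearMap.trace ℝ (EuclideanSpace ℝ (Fin n))
    (fderiv ℝ (unitNormalField φ) x : EuclideanSpace ℝ (Fin n) →ₗ[ℝ] EuclideanSpace ℝ (Fin n))
      / ((n : ℝ) - 1)

/-- The classical mean curvature of `E` at `p ∈ ∂E`, where `∂E` is `C²`, is `H`. The sign is such
that balls have positive curvature. The value does not depend on the defining function. -/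
def HasMeanCurvatureAt (E : Set (EuclideanSpace ℝ (Fin n))) (p : EuclideanSpace ℝ (Fin n))
    (H : ℝ) : Prop :=
  ∃ φ, IsC2DefiningFunctionAt E p φ ∧ levelSetMeanCurvature φ p = H

end

/-!
Write `f = χ_{Eᶜ} - χ_E` and `V(t) = ∫_{B_t(p)} f`. Everything about `I_s[E](p)` is read off from the
one-variable function `V`: since `|z| ^ (-n - s) = (n + s) ∫_{|z|}^∞ t ^ (-n - s - 1) dt`, Fubini gives
`I_s[E](p) = (n + s) ∫_0^∞ t ^ (-1 - s) (V(t) / t ^ n) dt`, the truncation at radius `ρ` contributing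
a boundary term (`integral_compl_ball_div_rpow_eq_ballMean`).

The geometric input is `V(t) / t ^ (n + 1) → ω_{n-1} H / (n + 1)` as `t → 0`
(`tendsto_signedMean_div`). Near `p`, `f` is the sign of a `C²` function `φ`. Subtracting the odd
function `sign ⟨∇φ(p), ·⟩` does not change `V` and leaves an integrand supported at height `O(t²)`
over the tangent hyperplane. In the coordinates `w = t² u ν + t x` it converges boundedly to
`sign (u + D²φ(x, x) / 2 |∇φ|) - sign u`, so the limit is the integral of a quadratic form over the unit
ball of the hyperplane, that is, a multiple of the tangential trace of `D²φ(p)`, which is the divergence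
of `∇φ / |∇φ|`. No local graph representation of `∂E` is needed.

Hence `V(t) / t ^ n` is bounded by a multiple of `min 1 t`. Dominated convergence yields the principal
value and continuity in `s`. As `s → 1` the probability measures `(1 - s) t ^ (-s) dt` on `(0, 1]`
concentrate at `0` and give the limit of `(1 - s) I_s`. As `s → 0` only large `t` matters; there
`V(t) = |B_t| - 2 |E ∩ B_t(p)|`, and replacing the centre `p` by `0` costs `O(t ^ (n - 1))`, so
`s I_s = ω_n - 2 α(s) + o(1)`, where `α(s)` is the quantity with upper limit `alphaBar E`. The
intermediate value theorem provides the zero.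
-/

/-! ### Layer-cake formula -/

lemma volume_real_ball_eq {n : ℕ} (q : EuclideanSpace ℝ (Fin n)) {t : ℝ} (ht : 0 < t) :
    volume.real (ball q t) = t ^ n * volume.real (ball (0 : EuclideanSpace ℝ (Fin n)) 1) := by
  simp [Measure.real, Measure.addHaar_ball_of_pos volume q ht, ht.le]

lemma integrableOn_ball_of_abs_le_one {n : ℕ} {g : EuclideanSpace ℝ (Fin n) → ℝ}
    (hg : AEStronglyMeasurable g volume) (hg1 : ∀ y, |g y| ≤ 1)
    (q : EuclideanSpace ℝ (Fin n)) (t : ℝ) : IntegrableOn g (ball q t) :=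
  Measure.integrableOn_of_bounded measure_ball_lt_top.ne hg (M := 1)
    (ae_of_all _ fun y => by simpa using hg1 y)

lemma abs_setIntegral_ball_le {n : ℕ} {g : EuclideanSpace ℝ (Fin n) → ℝ} (hg1 : ∀ y, |g y| ≤ 1)
    (q : EuclideanSpace ℝ (Fin n)) {t : ℝ} (ht : 0 < t) :
    |∫ y in ball q t, g y| ≤ volume.real (ball (0 : EuclideanSpace ℝ (Fin n)) 1) * t ^ n := by
  have := norm_setIntegral_le_of_norm_le_const (μ := volume) (s := ball q t) (f := g) (C := 1)
    measure_ball_lt_top (fun y _ => by simpa using hg1 y)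
  rwa [one_mul, volume_real_ball_eq q ht, mul_comm, Real.norm_eq_abs] at this

/-- Layer-cake formula for the radial kernel: writing `‖y - q‖ ^ (-(n + s))` as
`∫_{‖y - q‖}^∞ (n + s) t ^ (-(n + s) - 1) dt` reduces a singular integral to the integrals of `g`
over balls. -/
theorem integral_compl_ball_div_rpow {n : ℕ} {g : EuclideanSpace ℝ (Fin n) → ℝ}
    (hg : AEStronglyMeasurable g volume) (hg1 : ∀ y, |g y| ≤ 1) (q : EuclideanSpace ℝ (Fin n))
    {ρ s : ℝ} (hρ : 0 < ρ) (hs : 0 < s) :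
    ∫ y in (ball q ρ)ᶜ, g y / ‖y - q‖ ^ ((n : ℝ) + s)
      = ((n : ℝ) + s) * ∫ t in Ioi ρ, t ^ (-((n : ℝ) + s) - 1) *
          ((∫ y in ball q t, g y) - ∫ y in ball q ρ, g y) := by
  set a : ℝ := (n : ℝ) + s with ha
  have ha0 : 0 < a := by positivity
  set T : Set (EuclideanSpace ℝ (Fin n) × ℝ) := {z | ‖z.1 - q‖ < z.2} with hT
  have hTm : MeasurableSet T := by
    refine measurableSet_lt ?_ measurable_snd
    fun_prop
  set F : EuclideanSpace ℝ (Fin n) → ℝ → ℝ := fun y t =>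
    T.indicator (fun z => a * z.2 ^ (-a - 1) * g z.1) (y, t) with hF
  have hnorm : ∀ y, y ∈ (ball q ρ)ᶜ → ρ ≤ ‖y - q‖ := by
    intro y hy
    simpa [dist_eq_norm] using hy
  have hFmeas : AEStronglyMeasurable (Function.uncurry F)
      ((volume.restrict (ball q ρ)ᶜ).prod (volume.restrict (Ioi ρ))) := by
    refine AEStronglyMeasurable.indicator ?_ hTm
    refine AEStronglyMeasurable.mul ?_ (hg.restrict.comp_fst)
    exact Measurable.aestronglyMeasurable (by fun_prop)
  -- the slices of `F` at fixed radius
  have hslice : ∀ t, ρ < t → (fun y => F y t) = fun y => a * t ^ (-a - 1) *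
      (ball q t).indicator g y := by
    intro t _
    funext y
    by_cases h : ‖y - q‖ < t
    · have h1 : (y, t) ∈ T := h
      have h2 : y ∈ ball q t := by simpa [dist_eq_norm] using h
      simp [hF, h1, h2]
    · have h1 : (y, t) ∉ T := h
      have h2 : y ∉ ball q t := by simpa [dist_eq_norm] using h
      simp [hF, h1, h2]
  have hint : Integrable (Function.uncurry F)
      ((volume.restrict (ball q ρ)ᶜ).prod (volume.restrict (Ioi ρ))) := by
    rw [integrable_prod_iff' hFmeas]
    constructor
    · filter_upwards [ae_restrict_mem measurableSet_Ioi] with t ht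
      simp only [Function.uncurry]
      rw [hslice t ht]
      refine Integrable.const_mul ?_ _
      rw [integrable_indicator_iff measurableSet_ball]
      have := integrableOn_ball_of_abs_le_one hg hg1 q t
      exact IntegrableOn.mono_measure this Measure.restrict_le_self
    · have hdom : Integrable (fun t : ℝ => a *
          volume.real (ball (0 : EuclideanSpace ℝ (Fin n)) 1) * t ^ (-s - 1))
          (volume.restrict (Ioi ρ)) :=
        (integrableOn_Ioi_rpow_of_lt (by linarith) hρ).const_mul _
      refine hdom.mono' hFmeas.norm.prod_swap.integral_prod_right' ?_
      filter_upwards [ae_restrict_mem measurableSet_Ioi] with t ht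
      have ht0 : 0 < t := hρ.trans ht
      simp only [Function.uncurry]
      have h1 : (fun y => ‖F y t‖) = fun y => a * t ^ (-a - 1) *
          (ball q t).indicator (fun y => |g y|) y := by
        funext y
        rw [congrFun (hslice t ht) y, norm_mul, Real.norm_of_nonneg (by positivity)]
        by_cases h : y ∈ ball q t <;> simp [h]
      rw [h1, integral_const_mul, Real.norm_of_nonneg
        (mul_nonneg (by positivity) (integral_nonneg fun y => indicator_nonneg (by simp) y)),
        integral_indicator measurableSet_ball]
      have h2 : ∫ y in ball q t, |g y| ∂(volume.restrict (ball q ρ)ᶜ)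
          ≤ ∫ y in ball q t, |g y| := by
        refine integral_mono_measure (Measure.restrict_mono_measure Measure.restrict_le_self _)
          (ae_of_all _ fun y => abs_nonneg _) ?_
        exact (integrableOn_ball_of_abs_le_one hg hg1 q t).abs
      have h3 := (le_abs_self _).trans
        (abs_setIntegral_ball_le (g := fun y => |g y|) (by simpa using hg1) q ht0)
      have h4 : t ^ (-a - 1) * t ^ n = t ^ (-s - 1) := by
        rw [← Real.rpow_natCast, ← Real.rpow_add ht0]
        congr 1
        rw [ha]; ring
      calc _ ≤ a * t ^ (-a - 1) * (volume.real (ball (0 : EuclideanSpace ℝ (Fin n)) 1) * t ^ n) := by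
            gcongr
            exact h2.trans h3
        _ = _ := by rw [← h4]; ring
  have hswap := integral_integral_swap hint
  have hleft : ∫ y in (ball q ρ)ᶜ, g y / ‖y - q‖ ^ a
      = ∫ y in (ball q ρ)ᶜ, ∫ t in Ioi ρ, F y t := by
    refine setIntegral_congr_fun measurableSet_ball.compl fun y hy => ?_
    have hy' := hnorm y hy
    have hpos : 0 < ‖y - q‖ := hρ.trans_le hy'
    have h1 : ∀ t, F y t = (Ioi ‖y - q‖).indicator (fun t => a * g y * t ^ (-a - 1)) t := by
      intro t
      by_cases h : ‖y - q‖ < t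
      · have h1 : (y, t) ∈ T := h
        have h2 : t ∈ Ioi ‖y - q‖ := h
        simp only [hF, h1, h2, indicator_of_mem]
        ring
      · have h1 : (y, t) ∉ T := h
        have h2 : t ∉ Ioi ‖y - q‖ := h
        simp [hF, h1, h2]
    simp only [h1]
    rw [setIntegral_indicator measurableSet_Ioi, inter_eq_right.mpr (Ioi_subset_Ioi hy'),
      integral_const_mul, integral_Ioi_rpow_of_lt (by linarith) hpos]
    have h5 : -a - 1 + 1 = -a := by ring
    rw [h5, Real.rpow_neg hpos.le]
    field_simp
  have hright : ∫ t in Ioi ρ, ∫ y in (ball q ρ)ᶜ, F y t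
      = a * ∫ t in Ioi ρ, t ^ (-a - 1) * ((∫ y in ball q t, g y) - ∫ y in ball q ρ, g y) := by
    rw [← integral_const_mul]
    refine setIntegral_congr_fun measurableSet_Ioi fun t ht => ?_
    simp only [hslice t ht]
    have hsub : ball q ρ ⊆ ball q t := ball_subset_ball (le_of_lt ht)
    rw [integral_const_mul, setIntegral_indicator measurableSet_ball, inter_comm, ← sdiff_eq,
      setIntegral_sdiff measurableSet_ball (integrableOn_ball_of_abs_le_one hg hg1 q t) hsub, mul_assoc]
  rw [hleft, hswap, hright]

/-- The integral of a bounded function over concentric balls depends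
measurably on the radius: it is a difference of two monotone functions. -/
lemma measurable_setIntegral_ball {n : ℕ} {g : EuclideanSpace ℝ (Fin n) → ℝ}
    (hg : AEStronglyMeasurable g volume) (hg1 : ∀ y, |g y| ≤ 1)
    (q : EuclideanSpace ℝ (Fin n)) : Measurable fun t => ∫ y in ball q t, g y := by
  have hi := integrableOn_ball_of_abs_le_one hg hg1 q
  have hv : ∀ t, IntegrableOn (fun _ => (1 : ℝ)) (ball q t) := fun t =>
    integrableOn_const measure_ball_lt_top.ne
  have h1 : Monotone fun t => ∫ y in ball q t, (g y + 1) := by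
    intro t t' htt
    refine setIntegral_mono_set ((hi t').add (hv t')) (ae_of_all _ fun y => ?_)
      (ball_subset_ball htt).eventuallyLE
    have := (abs_le.1 (hg1 y)).1
    simp only [Pi.zero_apply]; linarith
  have h2 : Monotone fun t => ∫ y in ball q t, (1 : ℝ) := by
    intro t t' htt
    exact setIntegral_mono_set (hv t') (ae_of_all _ fun y => zero_le_one)
      (ball_subset_ball htt).eventuallyLE
  have : (fun t => ∫ y in ball q t, g y)
      = fun t => (∫ y in ball q t, (g y + 1)) - ∫ y in ball q t, (1 : ℝ) := by
    funext t
    rw [integral_add (hi t) (hv t)]; ring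
  rw [this]
  exact h1.measurable.sub h2.measurable

/-! ### Asymptotics of the one-dimensional integral -/

lemma integrableOn_Ioi_rpow_mul {w : ℝ → ℝ} {M s ρ : ℝ} (hw : Measurable w)
    (hM : ∀ t, 0 < t → |w t| ≤ M) (hs : 0 < s) (hρ : 0 < ρ) :
    IntegrableOn (fun t => t ^ (-1 - s) * w t) (Ioi ρ) := by
  refine Integrable.mono' (g := fun t => M * t ^ (-1 - s))
    ((integrableOn_Ioi_rpow_of_lt (by linarith) hρ).const_mul _)
    (Measurable.aestronglyMeasurable (by fun_prop)) ?_
  filter_upwards [ae_restrict_mem measurableSet_Ioi] with t ht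
  have ht0 : (0 : ℝ) < t := hρ.trans ht
  rw [norm_mul, Real.norm_of_nonneg (by positivity), Real.norm_eq_abs, mul_comm]
  gcongr
  exact hM t ht0

lemma integral_Ioi_one_rpow {s : ℝ} (hs : 0 < s) : ∫ t in Ioi (1 : ℝ), t ^ (-1 - s) = 1 / s := by
  rw [integral_Ioi_rpow_of_lt (by linarith) one_pos, Real.one_rpow]
  have : -1 - s + 1 = -s := by ring
  rw [this]
  field_simp

lemma abs_integral_Ioi_one_le {w : ℝ → ℝ} {M s : ℝ} (hM : ∀ t, 1 < t → |w t| ≤ M) (hs : 0 < s) :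
    |∫ t in Ioi 1, t ^ (-1 - s) * w t| ≤ M / s := by
  have h := norm_integral_le_of_norm_le (f := fun t => t ^ (-1 - s) * w t)
    (μ := volume.restrict (Ioi (1 : ℝ))) (g := fun t => M * t ^ (-1 - s))
    ((integrableOn_Ioi_rpow_of_lt (by linarith) one_pos).const_mul _) (by
      filter_upwards [ae_restrict_mem measurableSet_Ioi] with t ht
      have ht0 : (0 : ℝ) < t := one_pos.trans ht
      rw [norm_mul, Real.norm_of_nonneg (by positivity), Real.norm_eq_abs, mul_comm]
      gcongr
      exact hM t ht)
  rwa [integral_const_mul, integral_Ioi_one_rpow hs, mul_one_div, Real.norm_eq_abs] at h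

/-- A function on `(0, ∞)` that is bounded by a multiple of `min 1 t`; in the application it is the
mean of `χ_{Eᶜ} - χ_E` over the ball of radius `t` around a `C²` boundary point. -/
structure IsLinearlyVanishing (u : ℝ → ℝ) (M : ℝ) : Prop where
  measurable : Measurable u
  nonneg : 0 ≤ M
  abs_le_one : ∀ t, 0 < t → |u t| ≤ M
  abs_le_self : ∀ t, 0 < t → |u t| ≤ M * t

namespace IsLinearlyVanishing

variable {u : ℝ → ℝ} {M : ℝ}

/-- One majorant for all `t ^ (-1 - s) * u t` with `s` in the compact interval `[a, b]`. -/
lemma norm_rpow_mul_le (hu : IsLinearlyVanishing u M) {a b s : ℝ} (ha : a ≤ s) (hb : s ≤ b)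
    {t : ℝ} (ht : 0 < t) :
    ‖t ^ (-1 - s) * u t‖ ≤
      (Ioc 0 1).indicator (fun t => M * t ^ (-b)) t +
        (Ioi 1).indicator (fun t => M * t ^ (-1 - a)) t := by
  rw [norm_mul, Real.norm_of_nonneg (by positivity), Real.norm_eq_abs]
  rcases le_or_gt t 1 with h | h
  · have h1 : t ∈ Ioc (0 : ℝ) 1 := ⟨ht, h⟩
    have h2 : t ∉ Ioi (1 : ℝ) := not_lt.2 h
    rw [indicator_of_mem h1, indicator_of_notMem h2, add_zero]
    calc t ^ (-1 - s) * |u t| ≤ t ^ (-1 - s) * (M * t) := by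
          gcongr; exact hu.abs_le_self t ht
      _ = M * t ^ (-s) := by
          have : t ^ (-s) = t ^ (-1 - s) * t := by
            rw [← Real.rpow_add_one ht.ne']; congr 1; ring
          rw [this]; ring
      _ ≤ M * t ^ (-b) := by
          have := hu.nonneg
          gcongr 1
          exact Real.rpow_le_rpow_of_exponent_ge ht h (by linarith)
  · have h1 : t ∉ Ioc (0 : ℝ) 1 := fun h' => absurd h'.2 (not_le.2 h)
    have h2 : t ∈ Ioi (1 : ℝ) := h
    rw [indicator_of_mem h2, indicator_of_notMem h1, zero_add, mul_comm]
    have := hu.nonneg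
    gcongr
    · exact hu.abs_le_one t ht
    · exact h.le

lemma integrableOn_majorant {a b : ℝ} (M : ℝ) (ha : 0 < a) (hb : b < 1) :
    IntegrableOn (fun t => (Ioc 0 1).indicator (fun t => M * t ^ (-b)) t +
        (Ioi 1).indicator (fun t => M * t ^ (-1 - a)) t) (Ioi (0 : ℝ)) := by
  refine Integrable.add ?_ ?_
  · refine Integrable.mono_measure ?_ Measure.restrict_le_self
    rw [integrable_indicator_iff measurableSet_Ioc]
    refine Integrable.const_mul ?_ _
    exact ((intervalIntegral.intervalIntegrable_rpow' (by linarith)).1)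
  · refine Integrable.mono_measure ?_ Measure.restrict_le_self
    rw [integrable_indicator_iff measurableSet_Ioi]
    exact (integrableOn_Ioi_rpow_of_lt (by linarith) one_pos).const_mul _

lemma aestronglyMeasurable (hu : IsLinearlyVanishing u M) (s : ℝ) (μ : Measure ℝ) :
    AEStronglyMeasurable (fun t => t ^ (-1 - s) * u t) μ := by
  have := hu.measurable
  exact Measurable.aestronglyMeasurable (by fun_prop)

lemma integrableOn (hu : IsLinearlyVanishing u M) {s : ℝ} (hs : s ∈ Ioo (0 : ℝ) 1) :
    IntegrableOn (fun t => t ^ (-1 - s) * u t) (Ioi 0) := by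
  refine (integrableOn_majorant M hs.1 hs.2).mono' (hu.aestronglyMeasurable s _) ?_
  filter_upwards [ae_restrict_mem measurableSet_Ioi] with t ht
  exact hu.norm_rpow_mul_le le_rfl le_rfl ht

lemma continuousOn_integral (hu : IsLinearlyVanishing u M) :
    ContinuousOn (fun s => ∫ t in Ioi 0, t ^ (-1 - s) * u t) (Ioo (0 : ℝ) 1) := by
  intro s hs
  obtain ⟨a, ha0, has⟩ := exists_between hs.1
  obtain ⟨b, hsb, hb1⟩ := exists_between hs.2
  refine ContinuousAt.continuousWithinAt (continuousAt_of_dominated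
    (Eventually.of_forall fun s => hu.aestronglyMeasurable s _) ?_
    (integrableOn_majorant M ha0 hb1) ?_)
  · filter_upwards [Icc_mem_nhds has hsb] with s' hs'
    filter_upwards [ae_restrict_mem measurableSet_Ioi] with t ht
    exact hu.norm_rpow_mul_le hs'.1 hs'.2 ht
  · filter_upwards [ae_restrict_mem measurableSet_Ioi] with t ht
    have h : ContinuousAt (fun s : ℝ => t ^ (-1 - s)) s :=
      (Real.continuousAt_const_rpow (ne_of_gt ht)).comp (by fun_prop)
    exact h.mul continuousAt_const

lemma tendsto_integral_Ioi (hu : IsLinearlyVanishing u M) {s : ℝ} (hs : s ∈ Ioo (0 : ℝ) 1) :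
    Tendsto (fun ρ => ∫ t in Ioi ρ, t ^ (-1 - s) * u t) (𝓝[>] 0)
      (𝓝 (∫ t in Ioi 0, t ^ (-1 - s) * u t)) := by
  have h1 : ∀ᶠ ρ in 𝓝[>] (0 : ℝ), ∫ t in Ioi ρ, t ^ (-1 - s) * u t
      = ∫ t in Ioi 0, (Ioi ρ).indicator (fun t => t ^ (-1 - s) * u t) t := by
    filter_upwards [self_mem_nhdsWithin] with ρ hρ
    rw [setIntegral_indicator measurableSet_Ioi,
      inter_eq_right.mpr (Ioi_subset_Ioi (le_of_lt hρ))]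
  refine Tendsto.congr' (EventuallyEq.symm h1) ?_
  refine tendsto_integral_filter_of_dominated_convergence (fun t => ‖t ^ (-1 - s) * u t‖) ?_ ?_
    (hu.integrableOn hs).norm ?_
  · exact Eventually.of_forall fun ρ => (hu.aestronglyMeasurable s _).indicator measurableSet_Ioi
  · exact Eventually.of_forall fun ρ => ae_of_all _ fun t => norm_indicator_le_norm_self _ _
  · filter_upwards [ae_restrict_mem measurableSet_Ioi] with t ht
    refine tendsto_const_nhds.congr' ?_
    filter_upwards [nhdsWithin_le_nhds (Iio_mem_nhds ht)] with ρ hρ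
    rw [indicator_of_mem]
    exact hρ

lemma integral_Ioc_rpow {s : ℝ} (hs : s < 1) : ∫ t in Ioc (0 : ℝ) 1, t ^ (-s) = 1 / (1 - s) := by
  rw [← intervalIntegral.integral_of_le zero_le_one, integral_rpow (Or.inl (by linarith))]
  rw [Real.one_rpow, Real.zero_rpow (by linarith)]
  congr 1 <;> ring

lemma norm_rpow_mul_le_of_Ioc (hu : IsLinearlyVanishing u M) (s : ℝ) {t : ℝ}
    (ht : t ∈ Ioc (0 : ℝ) 1) : ‖t ^ (-1 - s) * u t‖ ≤ M * t ^ (-s) := by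
  have h := hu.norm_rpow_mul_le (a := s) (b := s) le_rfl le_rfl ht.1
  have h2 : t ∉ Ioi (1 : ℝ) := not_lt.2 ht.2
  rwa [indicator_of_mem ht, indicator_of_notMem h2, add_zero] at h

/-- The mass near the origin is bounded as `s → 0`. -/
lemma abs_integral_Ioc_le (hu : IsLinearlyVanishing u M) {s : ℝ} (hs : s < 1) :
    |∫ t in Ioc 0 1, t ^ (-1 - s) * u t| ≤ M / (1 - s) := by
  have h := norm_integral_le_of_norm_le (f := fun t => t ^ (-1 - s) * u t)
    (μ := volume.restrict (Ioc (0 : ℝ) 1)) (g := fun t => M * t ^ (-s))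
    (((intervalIntegral.intervalIntegrable_rpow' (by linarith)).1).const_mul _) (by
      filter_upwards [ae_restrict_mem measurableSet_Ioc] with t ht
      exact hu.norm_rpow_mul_le_of_Ioc s ht)
  rwa [integral_const_mul, integral_Ioc_rpow hs, mul_one_div, Real.norm_eq_abs] at h

lemma integral_split (hu : IsLinearlyVanishing u M) {s : ℝ} (hs : s ∈ Ioo (0 : ℝ) 1) :
    ∫ t in Ioi 0, t ^ (-1 - s) * u t
      = (∫ t in Ioc 0 1, t ^ (-1 - s) * u t) + ∫ t in Ioi 1, t ^ (-1 - s) * u t := by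
  have h := hu.integrableOn hs
  rw [← Ioc_union_Ioi_eq_Ioi zero_le_one] at h ⊢
  rw [setIntegral_union (Ioc_disjoint_Ioi le_rfl) measurableSet_Ioi h.left_of_union
    h.right_of_union]

/-- As `s → 1`, the measures `(1 - s) t ^ (-s) dt` on `(0, 1]` are probability measures that
concentrate at the origin. -/
lemma tendsto_one_sub_mul_integral (hu : IsLinearlyVanishing u M) {L : ℝ}
    (hL : Tendsto (fun t => u t / t) (𝓝[>] 0) (𝓝 L)) :
    Tendsto (fun s => (1 - s) * ∫ t in Ioi 0, t ^ (-1 - s) * u t) (𝓝[<] 1) (𝓝 L) := by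
  have hmem : Ioo (0 : ℝ) 1 ∈ 𝓝[<] (1 : ℝ) := Ioo_mem_nhdsLT zero_lt_one
  have hsub : Tendsto (fun s : ℝ => 1 - s) (𝓝[<] 1) (𝓝 0) :=
    tendsto_nhdsWithin_of_tendsto_nhds
      ((continuous_const.sub continuous_id).tendsto' _ _ (sub_self 1))
  have hsub' : Tendsto (fun s : ℝ => 1 - s) (𝓝[<] 1) (𝓝[>] 0) :=
    tendsto_nhdsWithin_of_tendsto_nhds_of_eventually_within _ hsub
      (by filter_upwards [hmem] with s hs using sub_pos.2 hs.2)
  have hfar : Tendsto (fun s => (1 - s) * ∫ t in Ioi 1, t ^ (-1 - s) * u t) (𝓝[<] 1) (𝓝 0) := by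
    have hb : Tendsto (fun s : ℝ => (1 - s) * (M / (1 / 2))) (𝓝[<] 1) (𝓝 0) := by
      simpa using hsub.mul_const (M / (1 / 2))
    refine squeeze_zero_norm' ?_ hb
    filter_upwards [Ioo_mem_nhdsLT (show (1 / 2 : ℝ) < 1 by norm_num)] with s hs
    rw [norm_mul, Real.norm_of_nonneg (by linarith [hs.2]), Real.norm_eq_abs]
    gcongr
    · linarith [hs.2]
    refine (abs_integral_Ioi_one_le (fun t ht => hu.abs_le_one t (one_pos.trans ht))
      (by linarith [hs.1])).trans ?_
    have := hu.nonneg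
    gcongr
    exact hs.1.le
  set h : ℝ → ℝ := (Ioc 0 1).indicator fun t => u t / t with hh
  have hhm : Measurable h := (hu.measurable.div measurable_id).indicator measurableSet_Ioc
  have hhM : ∀ t, |h t| ≤ M := by
    intro t
    by_cases ht : t ∈ Ioc (0 : ℝ) 1
    · rw [hh, indicator_of_mem ht, abs_div, abs_of_pos ht.1, div_le_iff₀ ht.1]
      exact hu.abs_le_self t ht.1
    · rw [hh, indicator_of_notMem ht, abs_zero]; exact hu.nonneg
  -- the substitution `y = t ^ (1 - s)`
  have hnear : ∀ s ∈ Ioo (0 : ℝ) 1, (1 - s) * ∫ t in Ioc 0 1, t ^ (-1 - s) * u t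
      = ∫ y in Ioc (0 : ℝ) 1, h (y ^ (1 / (1 - s))) := by
    intro s hs
    have hp : 0 < 1 - s := sub_pos.2 hs.2
    have hsubst := integral_comp_rpow_Ioi_of_pos (g := fun y => h (y ^ (1 / (1 - s)))) hp
    have h1 : ∫ y in Ioi (0 : ℝ), h (y ^ (1 / (1 - s)))
        = ∫ y in Ioc (0 : ℝ) 1, h (y ^ (1 / (1 - s))) := by
      refine setIntegral_eq_of_subset_of_forall_sdiff_eq_zero measurableSet_Ioi
        Ioc_subset_Ioi_self fun y hy => ?_
      have hy1 : 1 < y := by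
        by_contra hc
        exact hy.2 ⟨hy.1, not_lt.1 hc⟩
      have : y ^ (1 / (1 - s)) ∉ Ioc (0 : ℝ) 1 := fun hc =>
        absurd hc.2 (not_le.2 (Real.one_lt_rpow hy1 (by positivity)))
      exact indicator_of_notMem this _
    rw [← h1, ← hsubst, ← integral_const_mul, ← integral_indicator measurableSet_Ioc,
      ← integral_indicator measurableSet_Ioi]
    refine integral_congr_ae (ae_of_all _ fun t => ?_)
    by_cases ht : t ∈ Ioi (0 : ℝ)
    · have ht0 : (0 : ℝ) < t := ht
      have h2 : (t ^ (1 - s)) ^ (1 / (1 - s)) = t := by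
        rw [← Real.rpow_mul ht0.le, mul_one_div_cancel hp.ne', Real.rpow_one]
      simp only [indicator_of_mem ht, h2, smul_eq_mul]
      by_cases ht1 : t ∈ Ioc (0 : ℝ) 1
      · rw [hh, indicator_of_mem ht1, indicator_of_mem ht1]
        have h3 : t ^ (1 - s - 1) = t ^ (-1 - s) * t := by
          rw [← Real.rpow_add_one ht0.ne']; congr 1; ring
        rw [h3]
        field_simp
      · rw [hh, indicator_of_notMem ht1, indicator_of_notMem ht1, mul_zero]
    · have ht1 : t ∉ Ioc (0 : ℝ) 1 := fun hc => ht hc.1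
      rw [indicator_of_notMem ht1, indicator_of_notMem ht]
  have hlim : Tendsto (fun s : ℝ => ∫ y in Ioc (0 : ℝ) 1, h (y ^ (1 / (1 - s)))) (𝓝[<] 1)
      (𝓝 (∫ _ in Ioc (0 : ℝ) 1, L)) := by
    refine tendsto_integral_filter_of_dominated_convergence (fun _ => M) ?_ ?_
      (integrableOn_const measure_Ioc_lt_top.ne) ?_
    · exact Eventually.of_forall fun s =>
        (hhm.comp (by fun_prop)).aestronglyMeasurable
    · exact Eventually.of_forall fun s => ae_of_all _ fun y => hhM _
    · filter_upwards [ae_restrict_mem measurableSet_Ioc,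
        ae_restrict_of_ae (Measure.ae_ne volume (1 : ℝ))] with y hy hy1
      have hy1' : y < 1 := lt_of_le_of_ne hy.2 hy1
      have hexp : Tendsto (fun s : ℝ => 1 / (1 - s)) (𝓝[<] 1) atTop := by
        simpa only [one_div, Function.comp_def] using tendsto_inv_nhdsGT_zero.comp hsub'
      have hpow : Tendsto (fun s : ℝ => y ^ (1 / (1 - s))) (𝓝[<] 1) (𝓝[>] 0) := by
        refine tendsto_nhdsWithin_of_tendsto_nhds_of_eventually_within _ ?_
          (Eventually.of_forall fun s => Real.rpow_pos_of_pos hy.1 _)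
        exact (tendsto_rpow_atTop_of_base_lt_one y (by linarith [hy.1]) hy1').comp hexp
      refine Tendsto.comp (g := h) ?_ hpow
      refine hL.congr' ?_
      filter_upwards [Ioc_mem_nhdsGT (zero_lt_one' ℝ)] with t ht
      rw [hh, indicator_of_mem ht]
  have hL1 : ∫ _ in Ioc (0 : ℝ) 1, L = L := by simp
  rw [hL1] at hlim
  have := hlim.add hfar
  rw [add_zero] at this
  refine this.congr' ?_
  filter_upwards [hmem] with s hs
  rw [hu.integral_split hs, mul_add, hnear s hs]

/-- The mass near the origin does not contribute to the asymptotics as `s → 0`. -/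
lemma tendsto_mul_integral_Ioc (hu : IsLinearlyVanishing u M) :
    Tendsto (fun s => s * ∫ t in Ioc 0 1, t ^ (-1 - s) * u t) (𝓝[>] 0) (𝓝 0) := by
  have hb : Tendsto (fun s : ℝ => s * (M / (1 / 2))) (𝓝[>] 0) (𝓝 0) :=
    tendsto_nhdsWithin_of_tendsto_nhds
      ((continuous_id.mul continuous_const).tendsto' _ _ (by simp))
  refine squeeze_zero_norm' ?_ hb
  filter_upwards [Ioo_mem_nhdsGT (show (0 : ℝ) < 1 / 2 by norm_num)] with s hs
  rw [norm_mul, Real.norm_of_nonneg hs.1.le, Real.norm_eq_abs]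
  have h1 := hs.1
  gcongr
  refine (hu.abs_integral_Ioc_le (by linarith [hs.2])).trans ?_
  have := hu.nonneg
  gcongr
  linarith [hs.2]

end IsLinearlyVanishing

/-! ### Taylor expansion and divergence of the unit normal field -/

/-- Second-order Taylor expansion with Peano remainder. -/
theorem ContDiffAt.taylor_two_isLittleO {V : Type*} [NormedAddCommGroup V] [NormedSpace ℝ V]
    {φ : V → ℝ} {p : V} (h : ContDiffAt ℝ 2 φ p) :
    (fun w => φ (p + w) - φ p - fderiv ℝ φ p w - 1 / 2 * fderiv ℝ (fderiv ℝ φ) p w w)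
      =o[𝓝 0] fun w => ‖w‖ ^ 2 := by
  set D := fderiv ℝ (fderiv ℝ φ) p with hD
  have hsymm : ∀ v w, D v w = D w v := h.isSymmSndFDerivAt (by simp)
  have hD1 : HasFDerivAt (fderiv ℝ φ) D p :=
    ((h.fderiv_right (m := 1) (by norm_num)).differentiableAt (by norm_num)).hasFDerivAt
  have hdiff : ∀ᶠ w in 𝓝 (0 : V), DifferentiableAt ℝ φ (p + w) := by
    have h1 : ∀ᶠ y in 𝓝 p, DifferentiableAt ℝ φ y :=
      (h.eventually (by simp)).mono fun y hy => hy.differentiableAt (by norm_num)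
    have h2 : Tendsto (fun w => p + w) (𝓝 0) (𝓝 p) := by
      exact (continuous_const.add continuous_id : Continuous fun w => p + w).tendsto' _ _ (add_zero p)
    exact h2.eventually h1
  rw [Asymptotics.isLittleO_iff]
  intro ε hε
  have hlo := (hasFDerivAt_iff_isLittleO_nhds_zero.1 hD1).def hε
  obtain ⟨δ, hδ, hball⟩ := Metric.eventually_nhds_iff_ball.1 (hlo.and hdiff)
  filter_upwards [ball_mem_nhds 0 hδ] with w hw
  set R : V → ℝ := fun w => φ (p + w) - φ p - fderiv ℝ φ p w - 1 / 2 * D w w with hR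
  have hsub : closedBall (0 : V) ‖w‖ ⊆ ball 0 δ :=
    closedBall_subset_ball (by simpa using hw)
  have hderiv : ∀ z ∈ closedBall (0 : V) ‖w‖,
      HasFDerivWithinAt R (fderiv ℝ φ (p + z) - fderiv ℝ φ p - D z) (closedBall 0 ‖w‖) z := by
    intro z hz
    have h1 : HasFDerivAt (fun w => φ (p + w)) (fderiv ℝ φ (p + z)) z :=
      ((hball z (hsub hz)).2.hasFDerivAt).comp z ((hasFDerivAt_id z).const_add p)
    have h2 : HasFDerivAt (fun w => D w w) (D.precompR V z (ContinuousLinearMap.id ℝ V)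
        + D.precompL V (ContinuousLinearMap.id ℝ V) z) z :=
      D.hasFDerivAt_of_bilinear (hasFDerivAt_id z) (hasFDerivAt_id z)
    have h3 := ((h1.sub_const (φ p)).sub (fderiv ℝ φ p).hasFDerivAt).sub (h2.const_mul (1 / 2))
    refine HasFDerivAt.hasFDerivWithinAt (h3.congr_fderiv ?_)
    ext v
    have := hsymm v z
    simp only [sub_apply, add_apply, smul_apply, ContinuousLinearMap.precompR_apply,
      ContinuousLinearMap.precompL_apply, ContinuousLinearMap.compL_apply,
      ContinuousLinearMap.comp_apply, ContinuousLinearMap.id_apply, smul_eq_mul, this]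
    ring
  have hbound : ∀ z ∈ closedBall (0 : V) ‖w‖,
      ‖fderiv ℝ φ (p + z) - fderiv ℝ φ p - D z‖ ≤ ε * ‖w‖ := by
    intro z hz
    refine (hball z (hsub hz)).1.trans ?_
    gcongr
    simpa using hz
  have hmv := (convex_closedBall (0 : V) ‖w‖).norm_image_sub_le_of_norm_hasFDerivWithin_le
    hderiv hbound (x := 0) (y := w) (by simp) (by simp)
  have h0 : R 0 = 0 := by simp [hR]
  rw [h0, sub_zero, sub_zero] at hmv
  refine hmv.trans_eq ?_
  rw [norm_pow, norm_norm]; ring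

/-- Divergence of the unit normal field: in an orthonormal basis starting with the normal, only the
tangential second derivatives contribute. -/
theorem trace_fderiv_unitNormalField {m : ℕ} {φ : EuclideanSpace ℝ (Fin (m + 1)) → ℝ}
    {p : EuclideanSpace ℝ (Fin (m + 1))} (h : ContDiffAt ℝ 2 φ p) (h0 : ∇ φ p ≠ 0)
    (b : OrthonormalBasis (Fin (m + 1)) ℝ (EuclideanSpace ℝ (Fin (m + 1))))
    (hb : ‖∇ φ p‖ • b 0 = ∇ φ p) :
    LinearMap.trace ℝ (EuclideanSpace ℝ (Fin (m + 1)))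
        (fderiv ℝ (unitNormalField φ) p :
          EuclideanSpace ℝ (Fin (m + 1)) →ₗ[ℝ] EuclideanSpace ℝ (Fin (m + 1)))
      = ‖∇ φ p‖⁻¹ * ∑ i : Fin m, fderiv ℝ (fderiv ℝ φ) p (b i.succ) (b i.succ) := by
  set D := fderiv ℝ (fderiv ℝ φ) p with hD
  have hD1 : HasFDerivAt (fderiv ℝ φ) D p :=
    ((h.fderiv_right (m := 1) (by norm_num)).differentiableAt (by norm_num)).hasFDerivAt
  -- the Riesz isomorphism, as a linear (rather than conjugate-linear) map
  set J : StrongDual ℝ (EuclideanSpace ℝ (Fin (m + 1))) →L[ℝ] EuclideanSpace ℝ (Fin (m + 1)) :=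
    { toFun := (InnerProductSpace.toDual ℝ (EuclideanSpace ℝ (Fin (m + 1)))).symm
      map_add' := by simp
      map_smul' := by simp
      cont := LinearIsometryEquiv.continuous _ } with hJ
  set G' := J.comp D with hG'
  have hG : HasFDerivAt (fun y => ∇ φ y) G' p := J.hasFDerivAt.comp p hD1
  have hG'in : ∀ v w, inner ℝ w (G' v) = D v w := by
    intro v w
    rw [real_inner_comm]
    exact InnerProductSpace.toDual_symm_apply
  have hpos : 0 < ‖∇ φ p‖ := norm_pos_iff.2 h0
  have hnd : DifferentiableAt ℝ (fun y => ‖∇ φ y‖⁻¹) p :=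
    (hG.differentiableAt.norm ℝ h0).inv hpos.ne'
  have hU : HasFDerivAt (unitNormalField φ)
      (‖∇ φ p‖⁻¹ • G' + (fderiv ℝ (fun y => ‖∇ φ y‖⁻¹) p).smulRight (∇ φ p)) p :=
    hnd.hasFDerivAt.smul hG
  -- a unit vector field has derivative orthogonal to itself
  have hortho : inner ℝ (b 0) (fderiv ℝ (unitNormalField φ) p (b 0)) = 0 := by
    have hone : (fun y => inner ℝ (unitNormalField φ y) (unitNormalField φ y))
        =ᶠ[𝓝 p] fun _ => (1 : ℝ) := by
      filter_upwards [hG.continuousAt.eventually_ne h0] with y hy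
      rw [real_inner_self_eq_norm_sq, unitNormalField, norm_smul, norm_inv, norm_norm,
        inv_mul_cancel₀ (norm_ne_zero_iff.2 hy), one_pow]
    have h1 := hU.differentiableAt.hasFDerivAt.inner ℝ hU.differentiableAt.hasFDerivAt
    have h2 := h1.unique ((hasFDerivAt_const (1 : ℝ) p).congr_of_eventuallyEq hone)
    have h3 := DFunLike.congr_fun h2 (b 0)
    have h4 : unitNormalField φ p = b 0 := by
      rw [unitNormalField]
      conv_lhs => rw [← hb]
      rw [norm_smul, norm_norm, b.norm_eq_one, mul_one, smul_smul, inv_mul_cancel₀ hpos.ne',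
        one_smul]
    simp [h4] at h3
    rw [real_inner_comm] at h3
    linarith [real_inner_comm (b 0) (fderiv ℝ (unitNormalField φ) p (b 0))]
  rw [LinearMap.trace_eq_sum_inner _ b, Fin.sum_univ_succ]
  simp only [ContinuousLinearMap.coe_coe, hortho, zero_add]
  rw [Finset.mul_sum]
  refine Finset.sum_congr rfl fun i _ => ?_
  have hperp : inner ℝ (b i.succ) (∇ φ p) = 0 := by
    rw [← hb, inner_smul_right, b.inner_eq_zero (Fin.succ_ne_zero i), mul_zero]
  rw [hU.fderiv]
  simp [inner_add_right, inner_smul_right, hperp, hG'in]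

/-! ### Coordinates adapted to the normal, and moments of the ball -/

/-- The chart `(τ, x) ↦ τ b₀ + ∑ᵢ xᵢ bᵢ₊₁` of `ℝᵐ⁺¹` adapted to an orthonormal basis whose first
vector is to be the normal direction. -/
noncomputable def normalChart {m : ℕ}
    (b : OrthonormalBasis (Fin (m + 1)) ℝ (EuclideanSpace ℝ (Fin (m + 1)))) :
    ℝ × EuclideanSpace ℝ (Fin m) →L[ℝ] EuclideanSpace ℝ (Fin (m + 1)) :=
  (ContinuousLinearMap.fst ℝ ℝ (EuclideanSpace ℝ (Fin m))).smulRight (b 0) +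
    ∑ i : Fin m, ((EuclideanSpace.proj i).comp
      (ContinuousLinearMap.snd ℝ ℝ (EuclideanSpace ℝ (Fin m)))).smulRight (b i.succ)

section chart

variable {m : ℕ} (b : OrthonormalBasis (Fin (m + 1)) ℝ (EuclideanSpace ℝ (Fin (m + 1))))

lemma normalChart_apply (z : ℝ × EuclideanSpace ℝ (Fin m)) :
    normalChart b z = z.1 • b 0 + ∑ i : Fin m, z.2 i • b i.succ := by
  simp [normalChart]

lemma normalChart_eq_repr_symm (z : ℝ × EuclideanSpace ℝ (Fin m)) :
    normalChart b z = b.repr.symm (WithLp.toLp 2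
      ((MeasurableEquiv.piFinSuccAbove (fun _ : Fin (m + 1) => ℝ) 0).symm
        (z.1, WithLp.ofLp z.2))) := by
  rw [normalChart_apply, ← b.sum_repr_symm, Fin.sum_univ_succ]
  simp [MeasurableEquiv.piFinSuccAbove]

lemma inner_normalChart (z : ℝ × EuclideanSpace ℝ (Fin m)) :
    inner ℝ (b 0) (normalChart b z) = z.1 := by
  rw [normalChart_apply, inner_add_right, inner_sum, inner_smul_right,
    real_inner_self_eq_norm_sq, b.norm_eq_one]
  simp [inner_smul_right, b.inner_eq_zero (Fin.succ_ne_zero _).symm]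

lemma norm_normalChart_sq (z : ℝ × EuclideanSpace ℝ (Fin m)) :
    ‖normalChart b z‖ ^ 2 = z.1 ^ 2 + ‖z.2‖ ^ 2 := by
  rw [normalChart_eq_repr_symm, LinearIsometryEquiv.norm_map, EuclideanSpace.norm_sq_eq,
    EuclideanSpace.norm_sq_eq, Fin.sum_univ_succ]
  simp [MeasurableEquiv.piFinSuccAbove]

lemma measurePreserving_normalChart :
    MeasurePreserving (normalChart b) (volume.prod volume) volume := by
  have h1 : MeasurePreserving (fun z : ℝ × EuclideanSpace ℝ (Fin m) => (z.1, WithLp.ofLp z.2))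
      (volume.prod volume) (volume.prod volume) :=
    (MeasurePreserving.id _).prod (PiLp.volume_preserving_ofLp (Fin m))
  have h2 := (volume_preserving_piFinSuccAbove (fun _ : Fin (m + 1) => ℝ) 0).symm
  have h3 := PiLp.volume_preserving_toLp (Fin (m + 1))
  have h4 := b.repr.symm.measurePreserving
  have := h4.comp (h3.comp (h2.comp h1))
  refine (congrArg (fun f => MeasurePreserving f (volume.prod volume) volume) ?_).mpr this
  funext z
  exact normalChart_eq_repr_symm b z

/-- The parabolic dilation multiplies the normal coordinate by `r ^ 2` and the tangential ones by
`r`. -/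
lemma map_parabolic_normalChart {r : ℝ} (hr : 0 < r) :
    Measure.map (fun z : ℝ × EuclideanSpace ℝ (Fin m) => normalChart b (r ^ 2 * z.1, r • z.2))
      (volume.prod volume) = ENNReal.ofReal ((r ^ (m + 2))⁻¹) • volume := by
  have h1 : Measure.map (fun u : ℝ => r ^ 2 * u) volume
      = ENNReal.ofReal ((r ^ 2)⁻¹) • volume := by
    have := Real.map_volume_mul_left (a := r ^ 2) (by positivity)
    rw [this, abs_of_pos (by positivity)]
  have h2 : Measure.map (fun x : EuclideanSpace ℝ (Fin m) => r • x) volume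
      = ENNReal.ofReal ((r ^ m)⁻¹) • volume := by
    have := Measure.map_addHaar_smul (volume : Measure (EuclideanSpace ℝ (Fin m))) hr.ne'
    rw [this, finrank_euclideanSpace_fin, abs_of_pos (by positivity)]
  have hm : Measurable fun z : ℝ × EuclideanSpace ℝ (Fin m) => (r ^ 2 * z.1, r • z.2) := by
    fun_prop
  have h3 : Measure.map (fun z : ℝ × EuclideanSpace ℝ (Fin m) => (r ^ 2 * z.1, r • z.2))
      (volume.prod volume) = ENNReal.ofReal ((r ^ (m + 2))⁻¹) • volume.prod volume := by
    have := Measure.map_prod_map (volume : Measure ℝ)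
      (volume : Measure (EuclideanSpace ℝ (Fin m))) (f := fun u => r ^ 2 * u)
      (g := fun x => r • x) (by fun_prop) (by fun_prop)
    rw [h1, h2, Measure.prod_smul_left, Measure.prod_smul_right, smul_smul,
      ← ENNReal.ofReal_mul (by positivity), ← mul_inv, ← pow_add, add_comm 2 m] at this
    exact this.symm
  have h4 := Measure.map_map (μ := (volume : Measure ℝ).prod
    (volume : Measure (EuclideanSpace ℝ (Fin m)))) (normalChart b).continuous.measurable hm
  rw [h3, Measure.map_smul, (measurePreserving_normalChart b).map_eq] at h4
  exact h4.symm

/-- Integration in the parabolically rescaled chart, whose Jacobian is `r ^ (m + 2)`. -/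
lemma integral_eq_parabolic {r : ℝ} (hr : 0 < r) {g : EuclideanSpace ℝ (Fin (m + 1)) → ℝ}
    (hg : AEStronglyMeasurable g volume) :
    ∫ w, g w = r ^ (m + 2) * ∫ z : ℝ × EuclideanSpace ℝ (Fin m),
      g (normalChart b (r ^ 2 * z.1, r • z.2)) ∂(volume.prod volume) := by
  have hmap := map_parabolic_normalChart b hr
  have hm : Measurable fun z : ℝ × EuclideanSpace ℝ (Fin m) =>
      normalChart b (r ^ 2 * z.1, r • z.2) := by
    refine (normalChart b).continuous.measurable.comp ?_
    fun_prop
  have h := integral_map (f := g) hm.aemeasurable (by rw [hmap]; exact hg.smul_measure _)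
  rw [← h, hmap, integral_smul_measure, ENNReal.toReal_ofReal (by positivity), smul_eq_mul,
    mul_inv_cancel_left₀ (by positivity)]

lemma aestronglyMeasurable_parabolic {r : ℝ} (hr : 0 < r)
    {g : EuclideanSpace ℝ (Fin (m + 1)) → ℝ} (hg : AEStronglyMeasurable g volume) :
    AEStronglyMeasurable (fun z : ℝ × EuclideanSpace ℝ (Fin m) =>
      g (normalChart b (r ^ 2 * z.1, r • z.2))) (volume.prod volume) := by
  have hm : Measurable fun z : ℝ × EuclideanSpace ℝ (Fin m) =>
      normalChart b (r ^ 2 * z.1, r • z.2) := by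
    refine (normalChart b).continuous.measurable.comp ?_
    fun_prop
  refine AEStronglyMeasurable.comp_aemeasurable ?_ hm.aemeasurable
  rw [map_parabolic_normalChart b hr]
  exact hg.smul_measure _

lemma exists_orthonormalBasis_zero_eq {v : EuclideanSpace ℝ (Fin (m + 1))} (hv : ‖v‖ = 1) :
    ∃ b : OrthonormalBasis (Fin (m + 1)) ℝ (EuclideanSpace ℝ (Fin (m + 1))), b 0 = v := by
  have hort : Orthonormal ℝ (({0} : Set (Fin (m + 1))).domRestrict fun _ => v) := by
    constructor
    · intro i; exact hv
    · intro i j hij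
      exact absurd (Subsingleton.elim i j) hij
  obtain ⟨b, hb⟩ := hort.exists_orthonormalBasis_extension_of_card_eq (by simp)
  exact ⟨b, hb 0 rfl⟩

end chart

section moments

variable {m : ℕ}

lemma integrableOn_ball_of_continuous {f : EuclideanSpace ℝ (Fin m) → ℝ} (hf : Continuous f) :
    IntegrableOn f (ball 0 1) :=
  (hf.continuousOn.integrableOn_compact (isCompact_closedBall 0 1)).mono_set ball_subset_closedBall

lemma setIntegral_ball_comp_isometry
    (T : EuclideanSpace ℝ (Fin m) ≃ₗᵢ[ℝ] EuclideanSpace ℝ (Fin m))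
    (f : EuclideanSpace ℝ (Fin m) → ℝ) :
    ∫ x in ball 0 1, f (T x) = ∫ x in ball 0 1, f x := by
  have h := T.measurePreserving.setIntegral_preimage_emb
    T.toHomeomorph.measurableEmbedding f (ball 0 1)
  rwa [LinearIsometryEquiv.preimage_ball, map_zero] at h

lemma setIntegral_ball_norm_sq : ∫ x in ball (0 : EuclideanSpace ℝ (Fin m)) 1, ‖x‖ ^ 2
    = m * volume.real (ball (0 : EuclideanSpace ℝ (Fin m)) 1) / (m + 2) := by
  rcases Nat.eq_zero_or_pos m with rfl | hm
  · have : ∀ x : EuclideanSpace ℝ (Fin 0), ‖x‖ ^ 2 = 0 := fun x => by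
      rw [Subsingleton.elim x 0]; simp
    simp [this]
  have : Nonempty (Fin m) := ⟨⟨0, hm⟩⟩
  have h := integral_fun_norm_addHaar (volume : Measure (EuclideanSpace ℝ (Fin m)))
    ((Iio 1).indicator fun t : ℝ => t ^ 2)
  have h1 : ∀ x : EuclideanSpace ℝ (Fin m), (Iio 1).indicator (fun t : ℝ => t ^ 2) ‖x‖
      = (ball 0 1).indicator (fun x => ‖x‖ ^ 2) x := by
    intro x
    by_cases hx : ‖x‖ < 1 <;> simp [hx]
  simp only [h1] at h
  rw [integral_indicator measurableSet_ball] at h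
  have h2 : ∫ y in Ioi (0 : ℝ), y ^ (Module.finrank ℝ (EuclideanSpace ℝ (Fin m)) - 1) •
      (Iio 1).indicator (fun t : ℝ => t ^ 2) y = 1 / ((m : ℝ) + 2) := by
    have h3 : ∀ y : ℝ, y ^ (Module.finrank ℝ (EuclideanSpace ℝ (Fin m)) - 1) •
        (Iio 1).indicator (fun t : ℝ => t ^ 2) y = (Iio 1).indicator (fun t => t ^ (m + 1)) y := by
      intro y
      by_cases hy : y < 1
      · rw [indicator_of_mem (show y ∈ Iio (1 : ℝ) from hy),
          indicator_of_mem (show y ∈ Iio (1 : ℝ) from hy), finrank_euclideanSpace_fin, smul_eq_mul,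
          ← pow_add]
        congr 1; omega
      · rw [indicator_of_notMem (show y ∉ Iio (1 : ℝ) from hy),
          indicator_of_notMem (show y ∉ Iio (1 : ℝ) from hy), smul_zero]
    simp only [h3]
    rw [setIntegral_indicator measurableSet_Iio, Ioi_inter_Iio, ← integral_Ioc_eq_integral_Ioo,
      ← intervalIntegral.integral_of_le zero_le_one, integral_pow]
    push_cast
    norm_num [add_assoc]
  rw [h, h2, finrank_euclideanSpace_fin]
  simp [div_eq_mul_inv, mul_assoc]

lemma setIntegral_ball_coord_sq (i : Fin m) :
    ∫ x in ball (0 : EuclideanSpace ℝ (Fin m)) 1, x i ^ 2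
      = volume.real (ball (0 : EuclideanSpace ℝ (Fin m)) 1) / (m + 2) := by
  have hall : ∀ j, ∫ x in ball (0 : EuclideanSpace ℝ (Fin m)) 1, x j ^ 2
      = ∫ x in ball (0 : EuclideanSpace ℝ (Fin m)) 1, x i ^ 2 := by
    intro j
    rw [← setIntegral_ball_comp_isometry
      (LinearIsometryEquiv.piLpCongrLeft 2 ℝ ℝ (Equiv.swap i j)) (fun x => x j ^ 2)]
    simp [LinearIsometryEquiv.piLpCongrLeft_apply, Equiv.piCongrLeft'_apply]
  have hsum := setIntegral_ball_norm_sq (m := m)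
  simp only [EuclideanSpace.norm_sq_eq, Real.norm_eq_abs, sq_abs] at hsum
  rw [integral_finsetSum _ fun j _ => integrableOn_ball_of_continuous (by fun_prop)] at hsum
  simp only [hall, Finset.sum_const, Finset.card_univ, Fintype.card_fin, nsmul_eq_mul] at hsum
  have hm : (m : ℝ) ≠ 0 := Nat.cast_ne_zero.2 (Nat.pos_of_ne_zero fun h => by
    subst h; exact i.elim0).ne'
  rw [mul_div_assoc] at hsum
  exact mul_left_cancel₀ hm hsum

lemma setIntegral_ball_coord_mul {i j : Fin m} (hij : i ≠ j) :
    ∫ x in ball (0 : EuclideanSpace ℝ (Fin m)) 1, x i * x j = 0 := by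
  have h := setIntegral_ball_comp_isometry
    (LinearIsometryEquiv.piLpCongrRight 2 fun k =>
      if k = i then LinearIsometryEquiv.neg ℝ else LinearIsometryEquiv.refl ℝ ℝ)
    (fun x => x i * x j)
  simp [LinearIsometryEquiv.piLpCongrRight_apply, hij.symm, integral_neg] at h
  linarith

/-- The mean of a quadratic form over the unit ball is a multiple of its trace. -/
lemma setIntegral_ball_quadratic (B : Fin m → Fin m → ℝ) :
    ∫ x in ball (0 : EuclideanSpace ℝ (Fin m)) 1, ∑ i, ∑ j, B i j * (x i * x j)
      = (∑ i, B i i) * (volume.real (ball (0 : EuclideanSpace ℝ (Fin m)) 1) / (m + 2)) := by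
  rw [integral_finsetSum _ fun i _ => integrableOn_ball_of_continuous (by fun_prop),
    Finset.sum_mul]
  refine Finset.sum_congr rfl fun i _ => ?_
  rw [integral_finsetSum _ fun j _ => integrableOn_ball_of_continuous (by fun_prop),
    Finset.sum_eq_single i]
  · rw [integral_const_mul, ← setIntegral_ball_coord_sq i]
    simp [sq]
  · intro j _ hj
    rw [integral_const_mul, setIntegral_ball_coord_mul hj.symm, mul_zero]
  · simp

end moments

/-! ### Blow-up at a boundary point -/

lemma measurable_real_sign : Measurable Real.sign := by
  unfold Real.sign
  exact Measurable.ite measurableSet_Iio measurable_const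
    (Measurable.ite measurableSet_Ioi measurable_const measurable_const)

lemma abs_real_sign_le_one (x : ℝ) : |Real.sign x| ≤ 1 := by
  rcases Real.sign_apply_eq x with h | h | h <;> simp [h]

lemma real_sign_mul_of_pos {c : ℝ} (hc : 0 < c) (x : ℝ) : Real.sign (c * x) = Real.sign x := by
  rcases lt_trichotomy x 0 with h | h | h
  · rw [Real.sign_of_neg h, Real.sign_of_neg (mul_neg_of_pos_of_neg hc h)]
  · simp [h]
  · rw [Real.sign_of_pos h, Real.sign_of_pos (mul_pos hc h)]

lemma real_sign_add_eq {c u : ℝ} (h : |c| < |u|) : Real.sign (u + c) = Real.sign u := by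
  rcases abs_cases c with ⟨h1, _⟩ | ⟨h1, _⟩ <;> rcases abs_cases u with ⟨h2, h3⟩ | ⟨h2, h3⟩
  · rw [Real.sign_of_pos (by linarith), Real.sign_of_pos (by linarith)]
  · rw [Real.sign_of_neg (by linarith), Real.sign_of_neg (by linarith)]
  · rw [Real.sign_of_pos (by linarith), Real.sign_of_pos (by linarith)]
  · rw [Real.sign_of_neg (by linarith), Real.sign_of_neg (by linarith)]

lemma integral_sign_add_sub_sign (c : ℝ) : ∫ u, (Real.sign (u + c) - Real.sign u) = 2 * c := by
  rcases le_total 0 c with hc | hc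
  · have h : (fun u => Real.sign (u + c) - Real.sign u)
        =ᵐ[volume] (Ioo (-c) 0).indicator fun _ => (2 : ℝ) := by
      filter_upwards [Measure.ae_ne volume 0, Measure.ae_ne volume (-c)] with u h0 h1
      rcases lt_or_gt_of_ne h0 with h0 | h0 <;> rcases lt_or_gt_of_ne h1 with h1 | h1
      · rw [Real.sign_of_neg h0, Real.sign_of_neg (by linarith), indicator_of_notMem]
        · ring
        · exact fun h => by linarith [h.1]
      · rw [Real.sign_of_neg h0, Real.sign_of_pos (by linarith), indicator_of_mem (mem_Ioo.2 ⟨h1, h0⟩)]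
        norm_num
      · linarith
      · rw [Real.sign_of_pos h0, Real.sign_of_pos (by linarith), indicator_of_notMem]
        · ring
        · exact fun h => by linarith [h.2]
    rw [integral_congr_ae h, integral_indicator measurableSet_Ioo]
    simp [hc, mul_comm]
  · have h : (fun u => Real.sign (u + c) - Real.sign u)
        =ᵐ[volume] (Ioo 0 (-c)).indicator fun _ => (-2 : ℝ) := by
      filter_upwards [Measure.ae_ne volume 0, Measure.ae_ne volume (-c)] with u h0 h1
      rcases lt_or_gt_of_ne h0 with h0 | h0 <;> rcases lt_or_gt_of_ne h1 with h1 | h1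
      · rw [Real.sign_of_neg h0, Real.sign_of_neg (by linarith), indicator_of_notMem]
        · ring
        · exact fun h => by linarith [h.1]
      · linarith
      · rw [Real.sign_of_pos h0, Real.sign_of_neg (by linarith), indicator_of_mem (mem_Ioo.2 ⟨h0, h1⟩)]
        norm_num
      · rw [Real.sign_of_pos h0, Real.sign_of_pos (by linarith), indicator_of_notMem]
        · ring
        · exact fun h => by linarith [h.2]
    rw [integral_congr_ae h, integral_indicator measurableSet_Ioo]
    simp [hc, mul_comm]

section limit

variable {m : ℕ} {q : EuclideanSpace ℝ (Fin m) → ℝ}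

lemma integrable_box_indicator (K c : ℝ) :
    Integrable ((Icc (-K) K ×ˢ closedBall (0 : EuclideanSpace ℝ (Fin m)) 1).indicator
      fun _ => c) ((volume : Measure ℝ).prod volume) := by
  rw [integrable_indicator_iff (measurableSet_Icc.prod measurableSet_closedBall)]
  refine integrableOn_const ?_
  rw [Measure.prod_prod]
  exact ENNReal.mul_ne_top measure_Icc_lt_top.ne measure_closedBall_lt_top.ne

/-- Twice the signed volume between the graphs of `-q` and `0` over the unit ball. -/
lemma integral_sign_add_sub_sign_prod (hq : Continuous q) :
    ∫ z : ℝ × EuclideanSpace ℝ (Fin m),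
      (ball 0 1).indicator (fun x => Real.sign (z.1 + q x) - Real.sign z.1) z.2
        ∂(volume.prod volume)
      = 2 * ∫ x in ball 0 1, q x := by
  obtain ⟨K, hK⟩ := (isCompact_closedBall (0 : EuclideanSpace ℝ (Fin m)) 1).exists_bound_of_continuousOn
    hq.continuousOn
  have hmeas : Measurable fun z : ℝ × EuclideanSpace ℝ (Fin m) =>
      (ball 0 1).indicator (fun x => Real.sign (z.1 + q x) - Real.sign z.1) z.2 := by
    have h1 : Measurable fun z : ℝ × EuclideanSpace ℝ (Fin m) =>
        Real.sign (z.1 + q z.2) - Real.sign z.1 :=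
      (measurable_real_sign.comp (by fun_prop)).sub (measurable_real_sign.comp measurable_fst)
    have h2 : MeasurableSet (Prod.snd ⁻¹' ball 0 1 : Set (ℝ × EuclideanSpace ℝ (Fin m))) :=
      measurable_snd measurableSet_ball
    exact h1.indicator h2
  have hint : Integrable (fun z : ℝ × EuclideanSpace ℝ (Fin m) =>
      (ball 0 1).indicator (fun x => Real.sign (z.1 + q x) - Real.sign z.1) z.2)
        (volume.prod volume) := by
    refine (integrable_box_indicator K 2).mono' hmeas.aestronglyMeasurable (ae_of_all _ ?_)
    rintro ⟨u, x⟩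
    by_cases hx : x ∈ ball (0 : EuclideanSpace ℝ (Fin m)) 1
    · have hx' := ball_subset_closedBall hx
      simp only [indicator_of_mem hx]
      by_cases hu : u ∈ Icc (-K) K
      · rw [indicator_of_mem (mk_mem_prod hu hx')]
        calc _ ≤ |Real.sign (u + q x)| + |Real.sign u| := abs_sub _ _
          _ ≤ 2 := by linarith [abs_real_sign_le_one (u + q x), abs_real_sign_le_one u]
      · have h1 : |q x| < |u| := by
          refine lt_of_le_of_lt (hK x hx') (not_le.1 fun h => hu (abs_le.1 h))
        rw [real_sign_add_eq h1, sub_self, norm_zero]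
        exact indicator_nonneg (fun _ _ => zero_le_two) _
    · simp only [indicator_of_notMem hx, norm_zero]
      exact indicator_nonneg (fun _ _ => zero_le_two) _
  rw [integral_prod_symm _ hint, ← integral_const_mul, ← integral_indicator measurableSet_ball]
  refine integral_congr_ae (ae_of_all _ fun x => ?_)
  by_cases hx : x ∈ ball (0 : EuclideanSpace ℝ (Fin m)) 1
  · simp only [indicator_of_mem hx]
    exact integral_sign_add_sub_sign (q x)
  · simp [indicator_of_notMem hx]

end limit

lemma setIntegral_ball_sign_inner {V : Type*} [NormedAddCommGroup V] [InnerProductSpace ℝ V]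
    [FiniteDimensional ℝ V] [MeasurableSpace V] [BorelSpace V] (v : V) (r : ℝ) :
    ∫ w in ball (0 : V) r, Real.sign (inner ℝ v w) = 0 := by
  rw [← integral_indicator measurableSet_ball]
  have h := integral_neg_eq_self
    ((ball (0 : V) r).indicator fun w => Real.sign (inner ℝ v w)) volume
  have h2 : ∀ w : V, (ball (0 : V) r).indicator (fun w => Real.sign (inner ℝ v w)) (-w)
      = -(ball (0 : V) r).indicator (fun w => Real.sign (inner ℝ v w)) w := by
    intro w
    by_cases hw : w ∈ ball (0 : V) r
    · have hw' : -w ∈ ball (0 : V) r := by simpa using hw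
      rw [indicator_of_mem hw, indicator_of_mem hw', inner_neg_right, Real.sign_neg]
    · have hw' : -w ∉ ball (0 : V) r := by simpa using hw
      rw [indicator_of_notMem hw, indicator_of_notMem hw', neg_zero]
  simp only [h2, integral_neg] at h
  linarith

section blowup

variable {m : ℕ} {F φ : EuclideanSpace ℝ (Fin (m + 1)) → ℝ} {p : EuclideanSpace ℝ (Fin (m + 1))}
  {a : ℝ}

/-- If `F` is the sign of a function `φ` with `φ (p + w) = a ⟨b₀, w⟩ + D (w, w) / 2 + o(|w|²)`, then
`F` has mean of order `r` on balls of radius `r`, with a coefficient given by the tangential trace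
of `D`. Subtracting the odd function `sign ⟨b₀, w⟩`, which does not change the integral, leaves an
integrand supported in `|τ| ≲ r²`; in the parabolic coordinates `τ = r² u`, `x ↦ r x` it converges
to `sign (u + D (x, x) / 2 a) - sign u`. -/
theorem tendsto_setIntegral_ball_div_pow
    (b : OrthonormalBasis (Fin (m + 1)) ℝ (EuclideanSpace ℝ (Fin (m + 1))))
    (hF : AEStronglyMeasurable F volume) (hF1 : ∀ y, |F y| ≤ 1) (ha : 0 < a)
    (D : EuclideanSpace ℝ (Fin (m + 1)) →L[ℝ] EuclideanSpace ℝ (Fin (m + 1)) →L[ℝ] ℝ)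
    (hT : (fun w => φ (p + w) - a * inner ℝ (b 0) w - 1 / 2 * D w w) =o[𝓝 0] fun w => ‖w‖ ^ 2)
    (hneg : ∀ᶠ y in 𝓝 p, φ y < 0 → F y = -1) (hpos : ∀ᶠ y in 𝓝 p, 0 < φ y → F y = 1) :
    Tendsto (fun r => (∫ y in ball p r, F y) / r ^ (m + 2)) (𝓝[>] 0)
      (𝓝 (a⁻¹ * (∑ i : Fin m, D (b i.succ) (b i.succ)) *
        (volume.real (ball (0 : EuclideanSpace ℝ (Fin m)) 1) / (m + 2)))) := by
  set e := normalChart b with he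
  set q : EuclideanSpace ℝ (Fin m) → ℝ := fun x => (2 * a)⁻¹ * D (e (0, x)) (e (0, x)) with hq
  have hqc : Continuous q := by
    rw [hq]; fun_prop
  set Φ : ℝ → EuclideanSpace ℝ (Fin (m + 1)) → ℝ := fun r =>
    (ball 0 r).indicator fun w => F (p + w) - Real.sign (inner ℝ (b 0) w) with hΦ
  have hFp : AEStronglyMeasurable (fun w => F (p + w)) volume :=
    hF.comp_measurePreserving (measurePreserving_add_left volume p)
  have hsm : AEStronglyMeasurable
      (fun w : EuclideanSpace ℝ (Fin (m + 1)) => Real.sign (inner ℝ (b 0) w)) volume :=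
    (measurable_real_sign.comp (by fun_prop)).aestronglyMeasurable
  have hΦm : ∀ r, AEStronglyMeasurable (Φ r) volume := fun r =>
    (hFp.sub hsm).indicator measurableSet_ball
  have hΦint : ∀ r, ∫ w, Φ r w = ∫ y in ball p r, F y := by
    intro r
    rw [hΦ, integral_indicator measurableSet_ball, integral_sub
      (integrableOn_ball_of_abs_le_one hFp (fun w => hF1 _) 0 r)
      (integrableOn_ball_of_abs_le_one hsm (fun w => abs_real_sign_le_one _) 0 r),
      setIntegral_ball_sign_inner, sub_zero]
    have h := (measurePreserving_add_left volume p).setIntegral_preimage_emb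
      (MeasurableEquiv.addLeft p).measurableEmbedding F (ball p r)
    rw [← h]
    congr 2
    ext w
    simp
  -- the inner product and the norm in parabolic coordinates
  have hin : ∀ (r : ℝ) (z : ℝ × EuclideanSpace ℝ (Fin m)),
      inner ℝ (b 0) (e (r ^ 2 * z.1, r • z.2)) = r ^ 2 * z.1 := fun r z => inner_normalChart b _
  have hscale : ∀ (r : ℝ) (z : ℝ × EuclideanSpace ℝ (Fin m)),
      e (r ^ 2 * z.1, r • z.2) = r • e (r * z.1, z.2) := by
    intro r z
    rw [← map_smul]
    congr 1
    ext1
    · simp only [Prod.smul_mk, smul_eq_mul]; ring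
    · simp
  have hball : ∀ r : ℝ, 0 < r → ∀ z : ℝ × EuclideanSpace ℝ (Fin m),
      e (r ^ 2 * z.1, r • z.2) ∈ ball 0 r ↔ (r * z.1) ^ 2 + ‖z.2‖ ^ 2 < 1 := by
    intro r hr z
    rw [hscale, mem_ball_zero_iff, norm_smul, Real.norm_of_nonneg hr.le,
      ← norm_normalChart_sq b (r * z.1, z.2), sq_lt_one_iff₀ (norm_nonneg _)]
    exact ⟨fun h => by nlinarith, fun h => by nlinarith⟩
  have hlimit : 2 * ∫ x in ball (0 : EuclideanSpace ℝ (Fin m)) 1, q x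
      = a⁻¹ * (∑ i : Fin m, D (b i.succ) (b i.succ)) *
        (volume.real (ball (0 : EuclideanSpace ℝ (Fin m)) 1) / (m + 2)) := by
    have h1 : ∀ x, q x = (2 * a)⁻¹ *
        ∑ i, ∑ j, D (b i.succ) (b j.succ) * (x i * x j) := by
      intro x
      rw [hq]
      simp only [he, normalChart_apply, zero_smul, zero_add, map_sum, map_smul, sum_apply,
        smul_apply, smul_eq_mul]
      rw [Finset.sum_comm]
      congr 1
      refine Finset.sum_congr rfl fun i _ => ?_
      rw [Finset.mul_sum]
      refine Finset.sum_congr rfl fun j _ => ?_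
      ring
    simp only [h1]
    rw [integral_const_mul, setIntegral_ball_quadratic]
    field_simp
  rw [← hlimit, ← integral_sign_add_sub_sign_prod hqc]
  have hcongr : ∀ᶠ r in 𝓝[>] (0 : ℝ), ∫ z : ℝ × EuclideanSpace ℝ (Fin m),
      Φ r (e (r ^ 2 * z.1, r • z.2)) ∂(volume.prod volume)
        = (∫ y in ball p r, F y) / r ^ (m + 2) := by
    filter_upwards [self_mem_nhdsWithin] with r hr
    have hr0 : (0 : ℝ) < r := hr
    rw [← hΦint, integral_eq_parabolic b hr (hΦm r), mul_div_cancel_left₀ _ (by positivity)]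
  refine Tendsto.congr' hcongr ?_
  -- a common neighbourhood where `F` is the sign of `φ` and `φ` is nearly linear
  have htr : Tendsto (fun w => p + w) (𝓝 0) (𝓝 p) :=
    (continuous_const.add continuous_id : Continuous fun w => p + w).tendsto' _ _ (add_zero p)
  obtain ⟨δ, hδ, hnear⟩ := Metric.eventually_nhds_iff_ball.1
    (((htr.eventually hneg).and (htr.eventually hpos)).and (hT.def one_pos))
  set K := (‖D‖ / 2 + 1) / a with hK
  have hDle : ∀ w, |D w w| ≤ ‖D‖ * ‖w‖ ^ 2 := by
    intro w
    have := D.le_opNorm₂ w w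
    rw [Real.norm_eq_abs] at this
    linarith [sq ‖w‖, this.trans_eq (show ‖D‖ * ‖w‖ * ‖w‖ = ‖D‖ * ‖w‖ ^ 2 by ring)]
  have hdom : ∀ r ∈ Ioo 0 δ, ∀ z : ℝ × EuclideanSpace ℝ (Fin m),
      ‖Φ r (e (r ^ 2 * z.1, r • z.2))‖ ≤
        (Icc (-K) K ×ˢ closedBall (0 : EuclideanSpace ℝ (Fin m)) 1).indicator (fun _ => 2) z := by
    rintro r ⟨hr, hrδ⟩ z
    by_cases hw : e (r ^ 2 * z.1, r • z.2) ∈ ball 0 r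
    swap
    · simp only [hΦ, indicator_of_notMem hw, norm_zero]
      exact indicator_nonneg (fun _ _ => zero_le_two) _
    have hx : z.2 ∈ closedBall (0 : EuclideanSpace ℝ (Fin m)) 1 := by
      have := (hball r hr z).1 hw
      rw [mem_closedBall_zero_iff]
      nlinarith [sq_nonneg (r * z.1), norm_nonneg z.2]
    simp only [hΦ, indicator_of_mem hw, hin, real_sign_mul_of_pos (pow_pos hr 2)]
    by_cases hu : z.1 ∈ Icc (-K) K
    · rw [indicator_of_mem (show z ∈ _ ×ˢ _ from ⟨hu, hx⟩), Real.norm_eq_abs]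
      calc _ ≤ |F (p + e (r ^ 2 * z.1, r • z.2))| + |Real.sign z.1| := abs_sub _ _
        _ ≤ 2 := by linarith [hF1 (p + e (r ^ 2 * z.1, r • z.2)), abs_real_sign_le_one z.1]
    · have hu' : K < |z.1| := not_le.1 fun h => hu (abs_le.1 h)
      set w := e (r ^ 2 * z.1, r • z.2) with hwdef
      have hwr : ‖w‖ < r := mem_ball_zero_iff.1 hw
      obtain ⟨⟨h1, h2⟩, h3⟩ := hnear w (ball_subset_ball hrδ.le hw)
      rw [Real.norm_eq_abs, one_mul, norm_pow, norm_norm, hin] at h3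
      have h4 : ‖w‖ ^ 2 ≤ r ^ 2 := by gcongr
      have h5 : |φ (p + w) - a * (r ^ 2 * z.1)| ≤ (‖D‖ / 2 + 1) * r ^ 2 := by
        have h6 := hDle w
        have h7 : φ (p + w) - a * (r ^ 2 * z.1)
          = (φ (p + w) - a * (r ^ 2 * z.1) - 1 / 2 * D w w) + 1 / 2 * D w w := by ring
        rw [h7]
        refine (abs_add_le _ _).trans ?_
        rw [abs_mul, abs_of_pos (by norm_num : (0 : ℝ) < 1 / 2)]
        have h8 : ‖D‖ * ‖w‖ ^ 2 ≤ ‖D‖ * r ^ 2 := by gcongr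
        nlinarith
      have h9 : (‖D‖ / 2 + 1) < a * |z.1| := by
        rw [hK, div_lt_iff₀ ha] at hu'
        linarith
      have h10 : (‖D‖ / 2 + 1) * r ^ 2 < a * |z.1| * r ^ 2 := by gcongr
      have h11 : F (p + w) = Real.sign z.1 := by
        rcases abs_cases z.1 with ⟨h12, h13⟩ | ⟨h12, h13⟩
        · have hz : 0 < z.1 := by
            rcases h13.lt_or_eq with h | h
            · exact h
            · rw [← h] at h9
              simp at h9
              linarith [norm_nonneg D]
          rw [Real.sign_of_pos hz]
          refine h2 ?_
          rw [h12] at h10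
          linarith [(abs_le.1 h5).1]
        · rw [Real.sign_of_neg h13]
          refine h1 ?_
          rw [h12] at h10
          linarith [(abs_le.1 h5).2]
      rw [h11, sub_self, norm_zero]
      exact indicator_nonneg (fun _ _ => zero_le_two) _
  refine tendsto_integral_filter_of_dominated_convergence
    ((Icc (-K) K ×ˢ closedBall (0 : EuclideanSpace ℝ (Fin m)) 1).indicator fun _ => (2 : ℝ))
    ?_ ?_ (integrable_box_indicator K 2) ?_
  · filter_upwards [self_mem_nhdsWithin] with r hr
    exact aestronglyMeasurable_parabolic b hr (hΦm r)
  · filter_upwards [Ioo_mem_nhdsGT hδ] with r hr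
    exact ae_of_all _ (hdom r hr)
  -- pointwise convergence off the sphere `|x| = 1` and the graph `u = -q x`
  have hsphere : ∀ᵐ z ∂((volume : Measure ℝ).prod
      (volume : Measure (EuclideanSpace ℝ (Fin m)))), ‖z.2‖ ≠ 1 := by
    have h0 : ∀ᵐ x ∂(volume : Measure (EuclideanSpace ℝ (Fin m))), ‖x‖ ≠ 1 := by
      have := Measure.addHaar_sphere_of_ne_zero (volume : Measure (EuclideanSpace ℝ (Fin m)))
        0 one_ne_zero
      rw [ae_iff]
      convert this using 2
      ext x
      simp
    exact Measure.quasiMeasurePreserving_snd.ae h0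
  have hgraph : ∀ᵐ z ∂((volume : Measure ℝ).prod
      (volume : Measure (EuclideanSpace ℝ (Fin m)))), z.1 + q z.2 ≠ 0 := by
    have hms : MeasurableSet {z : ℝ × EuclideanSpace ℝ (Fin m) | ¬ (z.1 + q z.2 ≠ 0)} := by
      have : IsClosed {z : ℝ × EuclideanSpace ℝ (Fin m) | z.1 + q z.2 = 0} :=
        isClosed_eq (by fun_prop) continuous_const
      simpa using this.measurableSet
    rw [ae_iff, Measure.prod_apply_symm hms]
    refine lintegral_eq_zero_of_ae_eq_zero ?_
    refine ae_of_all _ fun x => ?_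
    have : (fun u : ℝ => (u, x)) ⁻¹' {z | ¬ (z.1 + q z.2 ≠ 0)} = {-q x} := by
      ext u
      simp [eq_neg_iff_add_eq_zero]
    change volume ((fun u : ℝ => (u, x)) ⁻¹' _) = 0
    rw [this, Real.volume_singleton]
  filter_upwards [hsphere, hgraph] with z hz1 hz2
  have hr0 : Tendsto (fun r : ℝ => r) (𝓝[>] 0) (𝓝 0) := tendsto_nhdsWithin_of_tendsto_nhds tendsto_id
  have hn : Tendsto (fun r : ℝ => (r * z.1) ^ 2 + ‖z.2‖ ^ 2) (𝓝[>] 0) (𝓝 (‖z.2‖ ^ 2)) := by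
    have := ((hr0.mul_const z.1).pow 2).add_const (‖z.2‖ ^ 2)
    simpa using this
  rcases lt_or_gt_of_ne hz1 with hlt | hgt
  swap
  · have hout : z.2 ∉ ball (0 : EuclideanSpace ℝ (Fin m)) 1 := by
      simpa using hgt.le
    rw [indicator_of_notMem hout]
    refine tendsto_const_nhds.congr' ?_
    filter_upwards [hn.eventually (lt_mem_nhds (show 1 < ‖z.2‖ ^ 2 by nlinarith)),
      self_mem_nhdsWithin] with r hr hrpos
    have : e (r ^ 2 * z.1, r • z.2) ∉ ball 0 r := fun h =>
      absurd ((hball r hrpos z).1 h) (not_lt.2 hr.le)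
    exact (indicator_of_notMem this _).symm
  · have hmem : z.2 ∈ ball (0 : EuclideanSpace ℝ (Fin m)) 1 := by simpa using hlt
    rw [indicator_of_mem hmem]
    set w : ℝ → EuclideanSpace ℝ (Fin (m + 1)) := fun r => e (r ^ 2 * z.1, r • z.2) with hwd
    have hwc : Tendsto (fun r : ℝ => e (r * z.1, z.2)) (𝓝[>] 0) (𝓝 (e (0, z.2))) := by
      have : Continuous fun r : ℝ => e (r * z.1, z.2) := by fun_prop
      exact tendsto_nhdsWithin_of_tendsto_nhds (this.tendsto' _ _ (by simp))
    have hw0 : Tendsto w (𝓝[>] 0) (𝓝 0) := by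
      have := hr0.smul hwc
      rw [zero_smul] at this
      exact this.congr fun r => (hscale r z).symm
    have hrem : Tendsto (fun r => (φ (p + w r) - a * inner ℝ (b 0) (w r) -
        1 / 2 * D (w r) (w r)) / r ^ 2) (𝓝[>] 0) (𝓝 0) := by
      have h1 := hT.comp_tendsto hw0
      have h2 : (fun r => ‖w r‖ ^ 2) =O[𝓝[>] 0] fun r => r ^ 2 := by
        refine Asymptotics.IsBigO.of_bound 1 ?_
        filter_upwards [self_mem_nhdsWithin,
          hn.eventually (gt_mem_nhds (show ‖z.2‖ ^ 2 < 1 by nlinarith [norm_nonneg z.2]))]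
          with r hr hr1
        have hr' : (0 : ℝ) < r := hr
        have := mem_ball_zero_iff.1 ((hball r hr z).2 hr1)
        rw [norm_pow, norm_norm, norm_pow, Real.norm_of_nonneg hr'.le, one_mul]
        gcongr
      exact (h1.trans_isBigO h2).tendsto_div_nhds_zero
    have hφlim : Tendsto (fun r => φ (p + w r) / r ^ 2) (𝓝[>] 0) (𝓝 (a * (z.1 + q z.2))) := by
      have h1 : Tendsto (fun r : ℝ => a * z.1 + 1 / 2 * D (e (r * z.1, z.2)) (e (r * z.1, z.2)))
          (𝓝[>] 0) (𝓝 (a * z.1 + 1 / 2 * D (e (0, z.2)) (e (0, z.2)))) := by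
        have : Continuous fun y => a * z.1 + 1 / 2 * D y y := by fun_prop
        exact (this.tendsto _).comp hwc
      have h2 := hrem.add h1
      have h3 : 0 + (a * z.1 + 1 / 2 * D (e (0, z.2)) (e (0, z.2))) = a * (z.1 + q z.2) := by
        rw [hq]; field_simp; ring
      rw [h3] at h2
      refine h2.congr' ?_
      filter_upwards [self_mem_nhdsWithin] with r hr
      have hr' : (0 : ℝ) < r := hr
      have h4 : w r = r • e (r * z.1, z.2) := hscale r z
      have h5 : inner ℝ (b 0) (w r) = r ^ 2 * z.1 := hin r z
      have h6 : D (w r) (w r) = r ^ 2 * D (e (r * z.1, z.2)) (e (r * z.1, z.2)) := by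
        rw [h4]; simp only [map_smul, smul_apply, smul_eq_mul]; ring
      rw [h5, h6]
      field_simp
      ring
    have hFw : ∀ᶠ r in 𝓝[>] (0 : ℝ), F (p + w r) = Real.sign (z.1 + q z.2) := by
      have hev := hw0.eventually ((htr.eventually hneg).and (htr.eventually hpos))
      rcases lt_or_gt_of_ne hz2 with h | h
      · filter_upwards [hev, hφlim.eventually (gt_mem_nhds (mul_neg_of_pos_of_neg ha h)),
          self_mem_nhdsWithin] with r h1 h2 hr
        have hr' : (0 : ℝ) < r := hr
        rw [Real.sign_of_neg h]
        refine h1.1 ?_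
        by_contra hc
        exact absurd (div_nonneg (not_lt.1 hc) (sq_nonneg r)) (not_le.2 h2)
      · filter_upwards [hev, hφlim.eventually (lt_mem_nhds (mul_pos ha h)),
          self_mem_nhdsWithin] with r h1 h2 hr
        have hr' : (0 : ℝ) < r := hr
        rw [Real.sign_of_pos h]
        refine h1.2 ?_
        by_contra hc
        exact absurd (div_nonpos_of_nonpos_of_nonneg (not_lt.1 hc) (sq_nonneg r)) (not_le.2 h2)
    refine tendsto_const_nhds.congr' ?_
    filter_upwards [hFw, self_mem_nhdsWithin,
      hn.eventually (gt_mem_nhds (show ‖z.2‖ ^ 2 < 1 by nlinarith [norm_nonneg z.2]))]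
      with r h1 hr h2
    have hin' : w r ∈ ball 0 r := (hball r hr z).2 h2
    have hr' : (0 : ℝ) < r := hr
    rw [hΦ]
    simp only
    rw [indicator_of_mem hin', h1, hin, real_sign_mul_of_pos (pow_pos hr' 2)]

end blowup

/-! ### Means over balls and lower limits -/

/-- The mean of `g` over `ball q t`, up to the volume of the unit ball. -/
noncomputable def ballMean {n : ℕ} (g : EuclideanSpace ℝ (Fin n) → ℝ)
    (q : EuclideanSpace ℝ (Fin n)) (t : ℝ) : ℝ :=
  (∫ y in ball q t, g y) / t ^ n

section ballMean

variable {n : ℕ} {g : EuclideanSpace ℝ (Fin n) → ℝ}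

lemma measurable_ballMean (hg : AEStronglyMeasurable g volume) (hg1 : ∀ y, |g y| ≤ 1)
    (q : EuclideanSpace ℝ (Fin n)) : Measurable (ballMean g q) :=
  (measurable_setIntegral_ball hg hg1 q).div (by fun_prop)

lemma abs_ballMean_le (hg1 : ∀ y, |g y| ≤ 1) (q : EuclideanSpace ℝ (Fin n)) {t : ℝ} (ht : 0 < t) :
    |ballMean g q t| ≤ volume.real (ball (0 : EuclideanSpace ℝ (Fin n)) 1) := by
  rw [ballMean, abs_div, abs_of_pos (pow_pos ht n), div_le_iff₀ (pow_pos ht n)]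
  exact abs_setIntegral_ball_le hg1 q ht

/-- The layer-cake formula with the truncation radius as a boundary term. -/
theorem integral_compl_ball_div_rpow_eq_ballMean (hg : AEStronglyMeasurable g volume)
    (hg1 : ∀ y, |g y| ≤ 1) (q : EuclideanSpace ℝ (Fin n)) {ρ s : ℝ} (hρ : 0 < ρ) (hs : 0 < s) :
    ∫ y in (ball q ρ)ᶜ, g y / ‖y - q‖ ^ ((n : ℝ) + s)
      = ((n : ℝ) + s) * (∫ t in Ioi ρ, t ^ (-1 - s) * ballMean g q t)
        - ρ ^ (-s) * ballMean g q ρ := by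
  have hn : 0 < (n : ℝ) + s := by positivity
  rw [integral_compl_ball_div_rpow hg hg1 q hρ hs]
  have h1 : ∀ t ∈ Ioi ρ, t ^ (-((n : ℝ) + s) - 1) *
      ((∫ y in ball q t, g y) - ∫ y in ball q ρ, g y)
        = t ^ (-1 - s) * ballMean g q t - t ^ (-((n : ℝ) + s) - 1) * ∫ y in ball q ρ, g y := by
    intro t ht
    have ht0 : 0 < t := hρ.trans ht
    have h2 : t ^ (-1 - s) = t ^ (-((n : ℝ) + s) - 1) * t ^ n := by
      rw [← Real.rpow_natCast, ← Real.rpow_add ht0]; congr 1; ring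
    rw [h2, ballMean]
    field_simp
  rw [setIntegral_congr_fun measurableSet_Ioi h1, integral_sub
    (integrableOn_Ioi_rpow_mul (measurable_ballMean hg hg1 q)
      (fun t ht => abs_ballMean_le hg1 q ht) hs hρ)
    ((integrableOn_Ioi_rpow_of_lt (by linarith) hρ).mul_const _),
    integral_mul_const, integral_Ioi_rpow_of_lt (by linarith) hρ, mul_sub]
  congr 1
  have h3 : -((n : ℝ) + s) - 1 + 1 = -((n : ℝ) + s) := by ring
  have h4 : ρ ^ (-((n : ℝ) + s)) = ρ ^ (-s) / ρ ^ n := by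
    rw [← Real.rpow_natCast, ← Real.rpow_sub hρ]; congr 1; ring
  rw [h3, h4, ballMean]
  field_simp

lemma one_add_mul_pow_le {x d : ℝ} (hx0 : 0 ≤ x) (hx1 : x ≤ 1) (hd : 0 ≤ d) (n : ℕ) :
    (1 + x * d) ^ n ≤ 1 + x * ((1 + d) ^ n - 1) := by
  induction n with
  | zero => simp
  | succ k ih =>
    have hP : 1 ≤ (1 + d) ^ k := one_le_pow₀ (by linarith)
    calc (1 + x * d) ^ (k + 1) = (1 + x * d) ^ k * (1 + x * d) := pow_succ _ _
      _ ≤ (1 + x * ((1 + d) ^ k - 1)) * (1 + x * d) := by gcongr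
      _ ≤ 1 + x * ((1 + d) ^ (k + 1) - 1) := by
        rw [pow_succ]
        have h1 : 0 ≤ ((1 + d) ^ k - 1) * d := mul_nonneg (by linarith) hd
        nlinarith [mul_nonneg (mul_nonneg hx0 (sub_nonneg.2 hx1)) h1]

/-- Moving the centre of a large ball changes the mean by `O(1 / t)`. -/
lemma ballMean_le_ballMean_add (hg : AEStronglyMeasurable g volume) (hg0 : ∀ y, 0 ≤ g y)
    (hg1 : ∀ y, |g y| ≤ 1) (q q' : EuclideanSpace ℝ (Fin n)) {t : ℝ} (ht : 1 ≤ t) :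
    ballMean g q t ≤ ballMean g q' t + volume.real (ball (0 : EuclideanSpace ℝ (Fin n)) 1) *
      ((1 + dist q q') ^ n - 1) * t⁻¹ := by
  set d := dist q q' with hd
  have hd0 : 0 ≤ d := dist_nonneg
  have ht0 : 0 < t := one_pos.trans_le ht
  set v := volume.real (ball (0 : EuclideanSpace ℝ (Fin n)) 1) with hv
  have hi := integrableOn_ball_of_abs_le_one hg hg1
  have h1 : ∫ y in ball q t, g y ≤ ∫ y in ball q' (t + d), g y :=
    setIntegral_mono_set (hi q' _) (ae_of_all _ hg0)
      (ball_subset_ball' le_rfl).eventuallyLE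
  have hsub : ball q' t ⊆ ball q' (t + d) := ball_subset_ball (by linarith)
  have h2 : (∫ y in ball q' (t + d), g y) - ∫ y in ball q' t, g y ≤ (t + d) ^ n * v - t ^ n * v := by
    rw [← setIntegral_sdiff measurableSet_ball (hi q' _) hsub]
    have hle := setIntegral_mono_on (μ := volume) (s := ball q' (t + d) \ ball q' t) (f := g)
      (g := fun _ => (1 : ℝ)) ((hi q' (t + d)).mono_set sdiff_subset)
      ((integrableOn_const measure_ball_lt_top.ne).mono_set sdiff_subset)
      (measurableSet_ball.diff measurableSet_ball) (fun y _ => (abs_le.1 (hg1 y)).2)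
    refine hle.trans_eq ?_
    rw [setIntegral_const, smul_eq_mul, mul_one, measureReal_sdiff hsub measurableSet_ball,
      volume_real_ball_eq q' ht0, volume_real_ball_eq q' (by linarith)]
  have h3 : (t + d) ^ n ≤ t ^ n * (1 + t⁻¹ * ((1 + d) ^ n - 1)) := by
    have h4 : t + d = t * (1 + t⁻¹ * d) := by field_simp
    rw [h4, mul_pow]
    gcongr
    exact one_add_mul_pow_le (by positivity) (inv_le_one_of_one_le₀ ht) hd0 n
  have hv0 : 0 ≤ v := measureReal_nonneg
  have h5 : (t + d) ^ n * v ≤ t ^ n * (1 + t⁻¹ * ((1 + d) ^ n - 1)) * v := by gcongr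
  have htn : 0 < t ^ n := pow_pos ht0 n
  rw [ballMean, ballMean, div_le_iff₀ htn, add_mul, div_mul_cancel₀ _ htn.ne']
  nlinarith

lemma abs_ballMean_sub_ballMean_le (hg : AEStronglyMeasurable g volume) (hg0 : ∀ y, 0 ≤ g y)
    (hg1 : ∀ y, |g y| ≤ 1) (q q' : EuclideanSpace ℝ (Fin n)) {t : ℝ} (ht : 1 ≤ t) :
    |ballMean g q t - ballMean g q' t| ≤ volume.real (ball (0 : EuclideanSpace ℝ (Fin n)) 1) *
      ((1 + dist q q') ^ n - 1) * t⁻¹ := by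
  have h1 := ballMean_le_ballMean_add hg hg0 hg1 q q' ht
  have h2 := ballMean_le_ballMean_add hg hg0 hg1 q' q ht
  rw [dist_comm] at h2
  rw [abs_le]
  constructor <;> linarith

lemma isLinearlyVanishing_ballMean (hg : AEStronglyMeasurable g volume) (hg1 : ∀ y, |g y| ≤ 1)
    {q : EuclideanSpace ℝ (Fin n)} {L : ℝ}
    (hL : Tendsto (fun t => ballMean g q t / t) (𝓝[>] 0) (𝓝 L)) :
    ∃ M, IsLinearlyVanishing (ballMean g q) M := by
  set v := volume.real (ball (0 : EuclideanSpace ℝ (Fin n)) 1) with hv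
  have hv0 : 0 ≤ v := measureReal_nonneg
  have h1 : ∀ᶠ t in 𝓝[>] (0 : ℝ), |ballMean g q t / t| < |L| + 1 :=
    hL.abs.eventually (gt_mem_nhds (lt_add_one _))
  obtain ⟨δ, hδ, h2⟩ := mem_nhdsGT_iff_exists_Ioo_subset.1 h1
  have hδ' : (0 : ℝ) < δ := hδ
  have hvδ : 0 ≤ v / δ := by positivity
  refine ⟨v + (|L| + 1) + v / δ, measurable_ballMean hg hg1 q, by positivity, ?_, ?_⟩
  · intro t ht
    have := abs_ballMean_le hg1 q ht
    linarith [abs_nonneg L]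
  · intro t ht
    rcases lt_or_ge t δ with h | h
    · have h3 : |ballMean g q t / t| < |L| + 1 := h2 ⟨ht, h⟩
      rw [abs_div, abs_of_pos ht, div_lt_iff₀ ht] at h3
      nlinarith
    · have h3 : v ≤ v / δ * t := by
        rw [div_mul_eq_mul_div, le_div_iff₀ hδ']
        gcongr
      have := abs_ballMean_le hg1 q ht
      nlinarith [abs_nonneg L]

end ballMean

/-- A lower limit of `c - 2 α + o(1)`, in the extended reals, for bounded `α`. -/
lemma liminf_coe_eq_of_tendsto {ι : Type*} {l : Filter ι} [l.NeBot] {x α : ι → ℝ} {c A : ℝ}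
    (hα0 : ∀ᶠ i in l, 0 ≤ α i) (hαA : ∀ᶠ i in l, α i ≤ A)
    (hx : Tendsto (fun i => x i + 2 * α i) l (𝓝 c)) :
    liminf (fun i => (x i : EReal)) l = ((c - 2 * limsup α l : ℝ) : EReal) := by
  have hbdd : IsBoundedUnder (· ≤ ·) l α := ⟨A, by simpa using hαA⟩
  have hcobdd : IsCoboundedUnder (· ≤ ·) l α :=
    IsBoundedUnder.isCoboundedUnder_le ⟨0, by simpa using hα0⟩
  refine le_antisymm ?_ ?_
  · refine EReal.le_of_forall_lt_iff_le.1 fun z hz => ?_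
    have hz' : c - 2 * limsup α l < z := by exact_mod_cast hz
    set ε := (z - (c - 2 * limsup α l)) / 3 with hε
    have hε0 : 0 < ε := by rw [hε]; linarith
    refine liminf_le_of_frequently_le ?_
    have h1 : ∃ᶠ i in l, limsup α l - ε < α i := frequently_lt_of_lt_limsup hcobdd (by linarith)
    refine (h1.and_eventually (hx.eventually (gt_mem_nhds (show c < c + ε by linarith)))).mono ?_
    rintro i ⟨h2, h3⟩
    have : x i ≤ z := by linarith
    exact_mod_cast this
  · refine EReal.ge_of_forall_gt_iff_ge.1 fun z hz => ?_
    have hz' : z < c - 2 * limsup α l := by exact_mod_cast hz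
    set ε := (c - 2 * limsup α l - z) / 3 with hε
    have hε0 : 0 < ε := by rw [hε]; linarith
    refine le_liminf_of_le (by isBoundedDefault) ?_
    have h1 : ∀ᶠ i in l, α i < limsup α l + ε := eventually_lt_of_limsup_lt (by linarith) hbdd
    filter_upwards [h1, hx.eventually (lt_mem_nhds (show c - ε < c by linarith))] with i h2 h3
    have : z ≤ x i := by linarith
    exact_mod_cast this

/-! ### Fractional mean curvature -/

lemma sphereArea_eq (m : ℕ) :
    sphereArea m = m * volume.real (ball (0 : EuclideanSpace ℝ (Fin m)) 1) := by
  rw [sphereArea, Measure.toSphere_real_apply_univ, finrank_euclideanSpace_fin]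

section fracMeanCurvature

variable {n : ℕ} {E : Set (EuclideanSpace ℝ (Fin n))}

lemma aestronglyMeasurable_indicator_one (hE : NullMeasurableSet E volume) :
    AEStronglyMeasurable (E.indicator fun _ => (1 : ℝ)) volume :=
  aestronglyMeasurable_const.indicator₀ hE

lemma abs_indicator_one_le (y : EuclideanSpace ℝ (Fin n)) :
    |E.indicator (fun _ => (1 : ℝ)) y| ≤ 1 := by
  by_cases h : y ∈ E <;> simp [h]

lemma abs_indicator_compl_sub_le (y : EuclideanSpace ℝ (Fin n)) :
    |Eᶜ.indicator (fun _ => (1 : ℝ)) y - E.indicator (fun _ => (1 : ℝ)) y| ≤ 1 := by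
  by_cases h : y ∈ E <;> simp [h]

lemma aestronglyMeasurable_indicator_compl_sub (hE : NullMeasurableSet E volume) :
    AEStronglyMeasurable
      (fun y => Eᶜ.indicator (fun _ => (1 : ℝ)) y - E.indicator (fun _ => (1 : ℝ)) y) volume :=
  (aestronglyMeasurable_indicator_one hE.compl).sub (aestronglyMeasurable_indicator_one hE)

/-- The mean of `χ_{Eᶜ} - χ_E` over balls around `q`. -/
noncomputable def signedMean (E : Set (EuclideanSpace ℝ (Fin n)))
    (q : EuclideanSpace ℝ (Fin n)) : ℝ → ℝ :=
  ballMean (fun y => Eᶜ.indicator (fun _ => (1 : ℝ)) y - E.indicator (fun _ => (1 : ℝ)) y) q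

lemma signedMean_eq (hE : NullMeasurableSet E volume) (q : EuclideanSpace ℝ (Fin n)) {t : ℝ}
    (ht : 0 < t) : signedMean E q t = volume.real (ball (0 : EuclideanSpace ℝ (Fin n)) 1)
      - 2 * ballMean (E.indicator fun _ => (1 : ℝ)) q t := by
  have h : ∀ y, Eᶜ.indicator (fun _ => (1 : ℝ)) y - E.indicator (fun _ => (1 : ℝ)) y
      = 1 - 2 * E.indicator (fun _ => (1 : ℝ)) y := by
    intro y
    by_cases h : y ∈ E
    · simp [h]; norm_num
    · simp [h]
  simp only [signedMean, ballMean, h]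
  have h1 : IntegrableOn (fun _ : EuclideanSpace ℝ (Fin n) => (1 : ℝ)) (ball q t) :=
    integrableOn_const measure_ball_lt_top.ne
  rw [integral_sub h1 ((integrableOn_ball_of_abs_le_one (aestronglyMeasurable_indicator_one hE)
      abs_indicator_one_le q t).const_mul 2), integral_const_mul, setIntegral_const, smul_eq_mul,
    mul_one, volume_real_ball_eq q ht]
  have := pow_pos ht n
  field_simp

/-- The principal value exists as soon as the signed mean over balls vanishes linearly. -/
lemma tendsto_fracMeanCurvatureTrunc (hE : NullMeasurableSet E volume)
    {q : EuclideanSpace ℝ (Fin n)} {M : ℝ} (hu : IsLinearlyVanishing (signedMean E q) M) {s : ℝ}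
    (hs : s ∈ Ioo (0 : ℝ) 1) :
    Tendsto (fun ρ => fracMeanCurvatureTrunc s ρ E q) (𝓝[>] 0)
      (𝓝 (((n : ℝ) + s) * ∫ t in Ioi 0, t ^ (-1 - s) * signedMean E q t)) := by
  have hb : Tendsto (fun ρ : ℝ => ρ ^ (-s) * signedMean E q ρ) (𝓝[>] 0) (𝓝 0) := by
    have h1 : Tendsto (fun ρ : ℝ => M * ρ ^ (1 - s)) (𝓝[>] 0) (𝓝 0) := by
      have h2 : ContinuousAt (fun ρ : ℝ => M * ρ ^ (1 - s)) 0 :=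
        continuousAt_const.mul
          (Real.continuousAt_rpow_const _ _ (Or.inr (by linarith [hs.2])))
      have h3 := h2.tendsto
      rw [Real.zero_rpow (by linarith [hs.2]), mul_zero] at h3
      exact tendsto_nhdsWithin_of_tendsto_nhds h3
    refine squeeze_zero_norm' ?_ h1
    filter_upwards [self_mem_nhdsWithin] with ρ hρ
    have hρ' : (0 : ℝ) < ρ := hρ
    have h4 : ρ ^ (1 - s) = ρ ^ (-s) * ρ := by
      rw [← Real.rpow_add_one hρ'.ne']; congr 1; ring
    rw [norm_mul, Real.norm_of_nonneg (by positivity), Real.norm_eq_abs, h4]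
    calc ρ ^ (-s) * |signedMean E q ρ| ≤ ρ ^ (-s) * (M * ρ) := by
          gcongr
          exact hu.abs_le_self ρ hρ
      _ = _ := by ring
  have h := ((hu.tendsto_integral_Ioi hs).const_mul ((n : ℝ) + s)).sub hb
  rw [sub_zero] at h
  refine h.congr' ?_
  filter_upwards [self_mem_nhdsWithin] with ρ hρ
  exact (integral_compl_ball_div_rpow_eq_ballMean (aestronglyMeasurable_indicator_compl_sub hE)
    abs_indicator_compl_sub_le q hρ hs.1).symm

lemma fracMeanCurvature_eq (hE : NullMeasurableSet E volume)
    {q : EuclideanSpace ℝ (Fin n)} {M : ℝ} (hu : IsLinearlyVanishing (signedMean E q) M) {s : ℝ}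
    (hs : s ∈ Ioo (0 : ℝ) 1) : fracMeanCurvature s E q
      = ((n : ℝ) + s) * ∫ t in Ioi 0, t ^ (-1 - s) * signedMean E q t :=
  (tendsto_fracMeanCurvatureTrunc hE hu hs).limUnder_eq

/-- The quantity whose upper limit as `s → 0` is `alphaBar E`. -/
noncomputable def massAtInfinity (E : Set (EuclideanSpace ℝ (Fin n))) (s : ℝ) : ℝ :=
  s * ∫ y in (ball (0 : EuclideanSpace ℝ (Fin n)) 1)ᶜ,
    E.indicator (fun _ => (1 : ℝ)) y / ‖y‖ ^ ((n : ℝ) + s)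

lemma massAtInfinity_eq (hE : NullMeasurableSet E volume) {s : ℝ} (hs : 0 < s) :
    massAtInfinity E s = s * (((n : ℝ) + s) * (∫ t in Ioi 1, t ^ (-1 - s) *
      ballMean (E.indicator fun _ => (1 : ℝ)) 0 t)
        - ballMean (E.indicator fun _ => (1 : ℝ)) 0 1) := by
  have h := integral_compl_ball_div_rpow_eq_ballMean (aestronglyMeasurable_indicator_one hE)
    abs_indicator_one_le 0 one_pos hs
  simp only [sub_zero, Real.one_rpow, one_mul] at h
  rw [massAtInfinity, h]

lemma massAtInfinity_nonneg {s : ℝ} (hs : 0 < s) : 0 ≤ massAtInfinity E s :=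
  mul_nonneg hs.le (integral_nonneg fun y =>
    div_nonneg (indicator_nonneg (fun _ _ => zero_le_one) y) (by positivity))

lemma ballMean_indicator_nonneg (q : EuclideanSpace ℝ (Fin n)) {t : ℝ} (ht : 0 < t) :
    0 ≤ ballMean (E.indicator fun _ => (1 : ℝ)) q t :=
  div_nonneg (integral_nonneg fun y => indicator_nonneg (fun _ _ => zero_le_one) y)
    (pow_pos ht n).le

lemma massAtInfinity_le (hE : NullMeasurableSet E volume) {s : ℝ} (hs : s ∈ Ioo (0 : ℝ) 1) :
    massAtInfinity E s ≤
      ((n : ℝ) + 1) * volume.real (ball (0 : EuclideanSpace ℝ (Fin n)) 1) := by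
  set v := volume.real (ball (0 : EuclideanSpace ℝ (Fin n)) 1) with hv
  have hs0 := hs.1
  have hv0 : 0 ≤ v := measureReal_nonneg
  have h1 := (le_abs_self _).trans (abs_integral_Ioi_one_le
    (w := ballMean (E.indicator fun _ => (1 : ℝ)) 0)
    (fun t ht => abs_ballMean_le abs_indicator_one_le 0 (one_pos.trans ht)) hs.1)
  have h2 := ballMean_indicator_nonneg (E := E) 0 one_pos
  rw [massAtInfinity_eq hE hs.1]
  calc _ ≤ s * (((n : ℝ) + s) * (v / s) - 0) := by gcongr
    _ = ((n : ℝ) + s) * v := by field_simp; ring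
    _ ≤ _ := by gcongr; exact hs.2.le

/-- As `s → 0` only the mass at infinity is seen, and there the centre of the kernel does not
matter. -/
lemma tendsto_mul_fracMeanCurvature_add_massAtInfinity (hE : NullMeasurableSet E volume)
    {q : EuclideanSpace ℝ (Fin n)} {M : ℝ} (hu : IsLinearlyVanishing (signedMean E q) M) :
    Tendsto (fun s => s * fracMeanCurvature s E q + 2 * massAtInfinity E s) (𝓝[>] 0)
      (𝓝 (sphereArea n)) := by
  set v := volume.real (ball (0 : EuclideanSpace ℝ (Fin n)) 1) with hv
  set χ : EuclideanSpace ℝ (Fin n) → ℝ := E.indicator fun _ => (1 : ℝ) with hχ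
  have hχm : AEStronglyMeasurable χ volume := aestronglyMeasurable_indicator_one hE
  have hχ1 : ∀ y, |χ y| ≤ 1 := abs_indicator_one_le
  have hχ0 : ∀ y, 0 ≤ χ y := fun y => indicator_nonneg (fun _ _ => zero_le_one) y
  set X : ℝ → ℝ := fun s =>
    ∫ t in Ioi 1, t ^ (-1 - s) * (ballMean χ q t - ballMean χ 0 t) with hX
  set C := v * ((1 + dist q 0) ^ n - 1) with hC
  have hv0 : 0 ≤ v := measureReal_nonneg
  have hC0 : 0 ≤ C := mul_nonneg hv0
    (sub_nonneg.2 (one_le_pow₀ (by linarith [dist_nonneg (x := q) (y := 0)])))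
  have hXb : ∀ s, 0 < s → |X s| ≤ C := by
    intro s hs
    have h1 : X s = ∫ t in Ioi 1, t ^ (-1 - (1 + s)) *
        (t * (ballMean χ q t - ballMean χ 0 t)) := by
      refine setIntegral_congr_fun measurableSet_Ioi fun t ht => ?_
      have ht0 : (0 : ℝ) < t := one_pos.trans ht
      have h2 : t ^ (-1 - s) = t ^ (-1 - (1 + s)) * t := by
        rw [← Real.rpow_add_one ht0.ne']; congr 1; ring
      simp only [h2]; ring
    rw [h1]
    refine (abs_integral_Ioi_one_le (M := C) (fun t ht => ?_) (by linarith)).trans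
      (div_le_self hC0 (by linarith))
    have ht0 : (0 : ℝ) < t := one_pos.trans ht
    have h3 := abs_ballMean_sub_ballMean_le hχm hχ0 hχ1 q 0 ht.le
    rw [abs_mul, abs_of_pos ht0]
    calc t * |ballMean χ q t - ballMean χ 0 t| ≤ t * (C * t⁻¹) := by gcongr
      _ = C := by field_simp
  have hid : Tendsto (fun s : ℝ => s) (𝓝[>] 0) (𝓝 0) :=
    tendsto_nhdsWithin_of_tendsto_nhds tendsto_id
  have hsX : Tendsto (fun s => s * X s) (𝓝[>] 0) (𝓝 0) := by
    have h1 : Tendsto (fun s : ℝ => s * C) (𝓝[>] 0) (𝓝 0) := by simpa using hid.mul_const C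
    refine squeeze_zero_norm' ?_ h1
    filter_upwards [self_mem_nhdsWithin] with s hs
    have hs0 : (0 : ℝ) < s := hs
    rw [norm_mul, Real.norm_of_nonneg hs0.le, Real.norm_eq_abs]
    gcongr
    exact hXb s hs
  have hn : Tendsto (fun s : ℝ => (n : ℝ) + s) (𝓝[>] 0) (𝓝 n) := by
    simpa using hid.const_add (n : ℝ)
  have hlim := (((hn.mul hu.tendsto_mul_integral_Ioc).add (hn.mul_const v)).sub
    ((hn.mul hsX).const_mul 2)).sub ((hid.mul_const (ballMean χ 0 1)).const_mul 2)
  have hval : (n : ℝ) * 0 + n * v - 2 * (n * 0) - 2 * (0 * ballMean χ 0 1) = sphereArea n := by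
    rw [sphereArea_eq]; ring
  rw [hval] at hlim
  refine hlim.congr' ?_
  filter_upwards [Ioo_mem_nhdsGT (zero_lt_one' ℝ)] with s hs
  have hs0 := hs.1
  have hiq : ∀ q, IntegrableOn (fun t => t ^ (-1 - s) * ballMean χ q t) (Ioi 1) := fun q =>
    integrableOn_Ioi_rpow_mul (measurable_ballMean hχm hχ1 q)
      (fun t ht => abs_ballMean_le hχ1 q ht) hs.1 one_pos
  have hXs : X s = (∫ t in Ioi 1, t ^ (-1 - s) * ballMean χ q t)
      - ∫ t in Ioi 1, t ^ (-1 - s) * ballMean χ 0 t := by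
    rw [← integral_sub (hiq q) (hiq 0)]
    simp only [hX, mul_sub]
  have hfar : ∫ t in Ioi 1, t ^ (-1 - s) * signedMean E q t
      = v / s - 2 * ∫ t in Ioi 1, t ^ (-1 - s) * ballMean χ q t := by
    have h1 : ∀ t ∈ Ioi (1 : ℝ), t ^ (-1 - s) * signedMean E q t
        = v * t ^ (-1 - s) - 2 * (t ^ (-1 - s) * ballMean χ q t) := by
      intro t ht
      rw [signedMean_eq hE q (one_pos.trans ht)]; ring
    rw [setIntegral_congr_fun measurableSet_Ioi h1, integral_sub
      ((integrableOn_Ioi_rpow_of_lt (by linarith) one_pos).const_mul v) ((hiq q).const_mul 2),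
      integral_const_mul, integral_const_mul, integral_Ioi_one_rpow hs.1, mul_one_div]
  rw [fracMeanCurvature_eq hE hu hs, hu.integral_split hs, massAtInfinity_eq hE hs.1, hfar, hXs]
  field_simp
  ring

end fracMeanCurvature

/-- The signed mean over small balls around a `C²` boundary point vanishes linearly, with slope
proportional to the mean curvature. -/
theorem tendsto_signedMean_div {m : ℕ} {E : Set (EuclideanSpace ℝ (Fin (m + 1)))}
    (hE : NullMeasurableSet E volume) {p : EuclideanSpace ℝ (Fin (m + 1))} (hp : p ∈ frontier E)
    (hm : m ≠ 0) {H : ℝ} (hH : HasMeanCurvatureAt E p H) :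
    Tendsto (fun t => signedMean E p t / t) (𝓝[>] 0) (𝓝 (sphereArea m * H / (m + 2))) := by
  obtain ⟨φ, hφ, rfl⟩ := hH
  have hφ0 : φ p = 0 := by
    rw [frontier_eq_closure_inter_closure] at hp
    have hc := hφ.contDiffAt.continuousAt
    rcases lt_trichotomy (φ p) 0 with h | h | h
    · have h1 : ∀ᶠ y in 𝓝 p, y ∈ E := by
        filter_upwards [hφ.mem_of_neg, hc.eventually (gt_mem_nhds h)] with y h1 h2 using h1 h2
      obtain ⟨y, hy, hy'⟩ := (h1.and_frequently (mem_closure_iff_frequently.1 hp.2)).exists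
      exact absurd hy hy'
    · exact h
    · have h1 : ∀ᶠ y in 𝓝 p, y ∉ E := by
        filter_upwards [hφ.notMem_of_pos, hc.eventually (lt_mem_nhds h)] with y h1 h2 using h1 h2
      obtain ⟨y, hy, hy'⟩ := (h1.and_frequently (mem_closure_iff_frequently.1 hp.1)).exists
      exact absurd hy' hy
  have ha : 0 < ‖∇ φ p‖ := norm_pos_iff.2 hφ.gradient_ne_zero
  obtain ⟨b, hb⟩ := exists_orthonormalBasis_zero_eq (v := ‖∇ φ p‖⁻¹ • ∇ φ p)
    (by rw [norm_smul, norm_inv, norm_norm, inv_mul_cancel₀ ha.ne'])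
  have hb' : ‖∇ φ p‖ • b 0 = ∇ φ p := by
    rw [hb, smul_smul, mul_inv_cancel₀ ha.ne', one_smul]
  have hgrad : ∀ w, ‖∇ φ p‖ * inner ℝ (b 0) w = fderiv ℝ φ p w := by
    intro w
    rw [← real_inner_smul_left, hb']
    exact InnerProductSpace.toDual_symm_apply
  have htaylor := hφ.contDiffAt.taylor_two_isLittleO
  simp only [hφ0, sub_zero, ← hgrad] at htaylor
  have hlim := tendsto_setIntegral_ball_div_pow
    (F := fun y => Eᶜ.indicator (fun _ => (1 : ℝ)) y - E.indicator (fun _ => (1 : ℝ)) y) b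
    (aestronglyMeasurable_indicator_compl_sub hE) abs_indicator_compl_sub_le ha _ htaylor
    (hφ.mem_of_neg.mono fun y h h' => by simp [h h'])
    (hφ.notMem_of_pos.mono fun y h h' => by simp [h h'])
  rw [← trace_fderiv_unitNormalField hφ.contDiffAt hφ.gradient_ne_zero b hb'] at hlim
  have hm' : (m : ℝ) ≠ 0 := Nat.cast_ne_zero.2 hm
  have hval : sphereArea m * levelSetMeanCurvature φ p / (m + 2)
      = LinearMap.trace ℝ (EuclideanSpace ℝ (Fin (m + 1)))
        (fderiv ℝ (unitNormalField φ) p :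
          EuclideanSpace ℝ (Fin (m + 1)) →ₗ[ℝ] EuclideanSpace ℝ (Fin (m + 1))) *
        (volume.real (ball (0 : EuclideanSpace ℝ (Fin m)) 1) / (m + 2)) := by
    rw [sphereArea_eq, levelSetMeanCurvature]
    push_cast
    rw [add_sub_cancel_right]
    field_simp
  rw [hval]
  refine hlim.congr fun t => ?_
  rw [signedMean, ballMean, div_div, ← pow_succ]

theorem theorem5p5 (n : ℕ) (E : Set (EuclideanSpace ℝ (Fin n))) (hE : NullMeasurableSet E volume)
    (p : EuclideanSpace ℝ (Fin n)) (hp : p ∈ frontier E)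
    (r : ℝ) (hr : 0 < r) (hC2 : HasC2BoundaryIn E (ball p r))
    (H : ℝ) (hH : HasMeanCurvatureAt E p H) (hneg : H < 0)
    (hα : alphaBar E < sphereArea n / 2) :
    -- the principal value defining `I_s[E](p)` exists for every `s ∈ (0, 1)`
    (∀ s ∈ Ioo (0 : ℝ) 1, Tendsto (fun ρ => fracMeanCurvatureTrunc s ρ E p) (𝓝[>] 0)
      (𝓝 (fracMeanCurvature s E p))) ∧
    ∃ σ₀ s' σ₁ : ℝ, 0 < σ₀ ∧ σ₀ < s' ∧ s' < σ₁ ∧ σ₁ < 1 ∧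
      (∀ s ∈ Ioc 0 σ₀, 0 < fracMeanCurvature s E p) ∧
      -- stated in the extended reals, where a lower limit always has its usual meaning
      liminf (fun s : ℝ => ((s * fracMeanCurvature s E p : ℝ) : EReal)) (𝓝[>] 0)
        = ((sphereArea n - 2 * alphaBar E : ℝ) : EReal) ∧
      fracMeanCurvature s' E p = 0 ∧
      (∀ s ∈ Ico σ₁ 1, fracMeanCurvature s E p < 0) ∧
      Tendsto (fun s : ℝ => (1 - s) * fracMeanCurvature s E p) (𝓝[<] 1)
        (𝓝 (sphereArea (n - 1) * H)) := by
  -- in dimension `0` no gradient is nonzero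
  obtain _ | m := n
  · obtain ⟨φ, hφ, -⟩ := hH
    exact absurd (Subsingleton.elim _ _) hφ.gradient_ne_zero
  -- in dimension `1` the mean curvature is `0`
  have hm : m ≠ 0 := by
    rintro rfl
    obtain ⟨φ, -, rfl⟩ := hH
    simp [levelSetMeanCurvature] at hneg
  have hL := tendsto_signedMean_div hE hp hm hH
  obtain ⟨M, hu⟩ : ∃ M, IsLinearlyVanishing (signedMean E p) M :=
    isLinearlyVanishing_ballMean (aestronglyMeasurable_indicator_compl_sub hE)
      abs_indicator_compl_sub_le hL
  have heq := fun s (hs : s ∈ Ioo (0 : ℝ) 1) => fracMeanCurvature_eq hE hu hs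
  -- behaviour as `s → 1`
  have hone : Tendsto (fun s : ℝ => (1 - s) * fracMeanCurvature s E p) (𝓝[<] 1)
      (𝓝 (sphereArea m * H)) := by
    have h1 : Tendsto (fun s : ℝ => ((m + 1 : ℕ) : ℝ) + s) (𝓝[<] 1) (𝓝 ((m : ℝ) + 2)) := by
      have hc : Continuous fun s : ℝ => ((m + 1 : ℕ) : ℝ) + s := by fun_prop
      exact tendsto_nhdsWithin_of_tendsto_nhds (hc.tendsto' _ _ (by push_cast; ring))
    have h2 := h1.mul (hu.tendsto_one_sub_mul_integral hL)
    rw [mul_div_cancel₀ _ (by positivity : (m : ℝ) + 2 ≠ 0)] at h2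
    refine h2.congr' ?_
    filter_upwards [Ioo_mem_nhdsLT (zero_lt_one' ℝ)] with s hs
    rw [heq s hs]
    ring
  -- behaviour as `s → 0`
  have hzero : liminf (fun s : ℝ => ((s * fracMeanCurvature s E p : ℝ) : EReal)) (𝓝[>] 0)
      = ((sphereArea (m + 1) - 2 * alphaBar E : ℝ) : EReal) := by
    refine liminf_coe_eq_of_tendsto (α := massAtInfinity E)
      (A := (((m + 1 : ℕ) : ℝ) + 1) *
        volume.real (ball (0 : EuclideanSpace ℝ (Fin (m + 1))) 1)) ?_ ?_
      (tendsto_mul_fracMeanCurvature_add_massAtInfinity hE hu)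
    · filter_upwards [self_mem_nhdsWithin] with s hs using massAtInfinity_nonneg hs
    · filter_upwards [Ioo_mem_nhdsGT (zero_lt_one' ℝ)] with s hs using massAtInfinity_le hE hs
  have hpos : ∀ᶠ s in 𝓝[>] (0 : ℝ), 0 < fracMeanCurvature s E p := by
    have h1 : ((0 : ℝ) : EReal)
        < liminf (fun s : ℝ => ((s * fracMeanCurvature s E p : ℝ) : EReal)) (𝓝[>] 0) := by
      rw [hzero]
      exact_mod_cast (by linarith : 0 < sphereArea (m + 1) - 2 * alphaBar E)
    filter_upwards [eventually_lt_of_lt_liminf h1, self_mem_nhdsWithin] with s h2 hs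
    exact pos_of_mul_pos_right (EReal.coe_lt_coe_iff.1 h2) (le_of_lt hs)
  have hnegev : ∀ᶠ s in 𝓝[<] (1 : ℝ), fracMeanCurvature s E p < 0 := by
    have hω : 0 < sphereArea m := by
      rw [sphereArea_eq]
      have h1 : 0 < volume.real (ball (0 : EuclideanSpace ℝ (Fin m)) 1) :=
        ENNReal.toReal_pos (measure_ball_pos _ _ one_pos).ne' measure_ball_lt_top.ne
      have h2 : (0 : ℝ) < m := Nat.cast_pos.2 (Nat.pos_of_ne_zero hm)
      positivity
    filter_upwards [hone.eventually (gt_mem_nhds (mul_neg_of_pos_of_neg hω hneg)),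
      self_mem_nhdsWithin] with s h1 hs
    by_contra hc
    exact absurd (mul_nonneg (sub_nonneg.2 (le_of_lt hs)) (not_lt.1 hc)) (not_le.2 h1)
  -- the bounds `1 / 3` and `2 / 3` keep the two intervals apart
  obtain ⟨c, hc, hposc⟩ :=
    (mem_nhdsGT_iff_exists_mem_Ioc_Ioo_subset (by norm_num : (0 : ℝ) < 1 / 3)).1 hpos
  obtain ⟨d, hd, hnegd⟩ :=
    (mem_nhdsLT_iff_exists_mem_Ico_Ioo_subset (by norm_num : (2 / 3 : ℝ) < 1)).1 hnegev
  obtain ⟨hc0, hc1⟩ := hc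
  obtain ⟨hd0, hd1⟩ := hd
  have hp0 : ∀ s ∈ Ioc 0 (c / 2), 0 < fracMeanCurvature s E p := fun s hs =>
    hposc ⟨hs.1, by linarith [hs.2]⟩
  have hn1 : ∀ s ∈ Ico ((d + 1) / 2) 1, fracMeanCurvature s E p < 0 := fun s hs =>
    hnegd ⟨by linarith [hs.1], hs.2⟩
  have hσp := hp0 (c / 2) ⟨by linarith, le_rfl⟩
  have hσn := hn1 ((d + 1) / 2) ⟨le_rfl, by linarith⟩
  have hcont : ContinuousOn (fun s => fracMeanCurvature s E p) (Ioo 0 1) :=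
    ((continuous_const.add continuous_id).continuousOn.mul hu.continuousOn_integral).congr heq
  obtain ⟨s', hs', hs0⟩ := intermediate_value_Icc' (show c / 2 ≤ (d + 1) / 2 by linarith)
    (hcont.mono (Icc_subset_Ioo (by linarith) (by linarith))) ⟨hσn.le, hσp.le⟩
  have hs0 : fracMeanCurvature s' E p = 0 := hs0
  refine ⟨fun s hs => ?_, c / 2, s', (d + 1) / 2, by linarith, lt_of_le_of_ne hs'.1 ?_,
    lt_of_le_of_ne hs'.2 ?_, by linarith, hp0, hzero, hs0, hn1, hone⟩
  · rw [heq s hs]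
    exact tendsto_fracMeanCurvatureTrunc hE hu hs
  · rintro rfl
    exact hσp.ne' hs0
  · rintro rfl
    exact hσn.ne hs0
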